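/- Let $d\ge 0$ be an integer, let $K\subset\mathbb R^d$ be compact, and let $\mathcal P(K)$ be the set of Borel probability measures on $K$, endowed with the weak topology. For $\mu\in\mathcal P(K)$ and $x\in K$ let $$\underline{\dim}_{\rm loc}(\mu;x)=\liminf_{r\to0^+}\frac{\log\mu(B(x,r))}{\log r}\in[0,+\infty],$$ where $B(x,r)$ is the open Euclidean ball of center $x$ and radius $r$ and $\log 0=-\infty$, and for $\alpha\ge0$ let $$E_-(\mu;\alpha)=\{x\in K:\ \underline{\dim}_{\rm loc}(\mu;x)=\alpha\}.$$ Write $\dim_{\mathcal H}$ for Hausdorff dimension (with $\dim_{\mathcal H}\varnothing=0$) and $\mathcal H^s$ for $s$-dimensional Hausdorff measure. Then there is a dense $G_\delta$ subset $\mathcal R$ of $\mathcal P(K)$ such that every $\mu\in\mathcal R$ satisfies $$\dim_{\mathcal H}\big(E_-(\mu;\alpha)\big)=\alpha\qquad\text{for every }\alpha\in[0,\dim_{\mathcal H}(K)),$$ and, if $\mathcal H^{\dim_{\mathcal H}(K)}(K)>0$, this equality also holds for $\alpha=\dim_{\mathcal H}(K)$. -/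

import Mathlib

open MeasureTheory Filter Topology
open scoped NNReal ENNReal

/-- The lower local dimension `liminf_{r → 0⁺} log μ(B(x, r)) / log r` of a measure at a point,
computed in the extended reals: for `0 < r < 1` with `μ (B(x, r)) = 0` the quotient is
`⊥ / log r = ⊤`, in accordance with the convention `log 0 = -∞`. -/
noncomputable def lowerLocalDim {X : Type*} [PseudoMetricSpace X] [MeasurableSpace X]
    (μ : Measure X) (x : X) : EReal :=
  liminf (fun r : ℝ => ENNReal.log (μ (Metric.ball x r)) / ((Real.log r : ℝ) : EReal)) (𝓝[>] 0)

/-- The level set `E₋(μ; α)` of the points at which the lower local dimension of `μ` is `α`. -/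
def lowerLevelSet {X : Type*} [PseudoMetricSpace X] [MeasurableSpace X]
    (μ : Measure X) (α : ℝ≥0) : Set X :=
  {x | lowerLocalDim μ x = ((α : ℝ) : EReal)}

/-! The upper bound holds for every finite measure. Where the lower local dimension is at most `β`,
arbitrarily small balls have mass at least `r ^ s`, for each `s > β`. A Vitali covering by such
balls bounds the `s`-dimensional Hausdorff measure (`hausdorffMeasure_ne_top_of_frequently`).
Genericity is thus needed only to make the level sets large.

If `μH[t] K > 0`, some dyadic cell is good, that is, its `t`-dimensional net content is comparable
to the `t`-th power of its scale (`exists_good`). For `0 < α ≤ t`, every good cell contains finite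
antichains of arbitrarily deep good cells on which the weights `2⁻ˡᵅ` are spread as in Frostman's
lemma (`exists_isSpread`). Mixing a small proportion of point masses on such families into any
measure gives a nearby measure whose mass near each chosen cell exceeds `2⁻ˡᵅ` up to a small error
in the exponent. This condition is open, so the measures that satisfy it with errors tending to 0
contain a dense Gδ, `chargingResidual`.

For `μ` in that set the construction iterates, because the chosen cells are again good. The
resulting tree carries a limit measure `ν` satisfying `ν A ≲ 2⁻ˡᵇ` for sets of diameter at most
`2⁻ˡ`, with any `b < α` once `ℓ` is large, and `ν`-almost every point has lower local dimension at
most `α` for `μ`. By the mass distribution principle `ν` vanishes on sets of dimension less than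
`α`, hence, by the upper bound, on the points of lower local dimension at most `β < α`. So `ν` lives
on the level set, which has dimension at least `α` (`le_dimH_lowerLevelSet`). Countably many `t`
serve all `α`, and allowing `α = t` gives the endpoint. -/

/-- A nested sequence of finite partitions of a metric space, the cells of level `ℓ` having
diameter `O(2⁻ˡ)` and a set of diameter `O(2⁻ˡ)` meeting boundedly many of them. The map `rep ℓ`
sends a point to a distinguished point of its cell of level `ℓ`. -/
structure CellSystem (X : Type*) [PseudoMetricSpace X] where
  rep : ℕ → X → X
  rep_rep : ∀ ℓ x, rep ℓ (rep ℓ x) = rep ℓ x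
  rep_congr : ∀ {k ℓ : ℕ} {x y : X}, k ≤ ℓ → rep ℓ x = rep ℓ y → rep k x = rep k y
  finite_range : ∀ ℓ, (Set.range (rep ℓ)).Finite
  C : ℝ
  dist_rep : ∀ ℓ x, dist x (rep ℓ x) ≤ C * 2⁻¹ ^ ℓ
  M : ℕ
  encard_image_le : ∀ (ℓ : ℕ) (A : Set X),
    (∀ x ∈ A, ∀ y ∈ A, dist x y ≤ 4 * 2⁻¹ ^ ℓ) → (rep ℓ '' A).encard ≤ M

/-- The `s`-th power `2⁻ˡˢ` of the scale of a cell of level `ℓ`. -/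
noncomputable def cellWeight {X : Type*} (s : ℝ) (p : ℕ × X) : ℝ := (2 : ℝ) ^ (-(s * p.1))

section cellWeight

variable {X : Type*} {s t : ℝ} {p q : ℕ × X}

theorem cellWeight_pos (s : ℝ) (p : ℕ × X) : 0 < cellWeight s p := by
  unfold cellWeight; positivity

theorem cellWeight_add (s t : ℝ) (p : ℕ × X) :
    cellWeight (s + t) p = cellWeight s p * cellWeight t p := by
  unfold cellWeight
  rw [← Real.rpow_add two_pos]
  ring_nf

theorem cellWeight_sub (s t : ℝ) (p : ℕ × X) :
    cellWeight (s - t) p = cellWeight s p / cellWeight t p := by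
  unfold cellWeight
  rw [← Real.rpow_sub two_pos]
  ring_nf

theorem cellWeight_le_of_level_le (hs : 0 ≤ s) (h : q.1 ≤ p.1) :
    cellWeight s p ≤ cellWeight s q := by
  unfold cellWeight
  have : (q.1 : ℝ) ≤ p.1 := by exact_mod_cast h
  exact Real.rpow_le_rpow_of_exponent_le one_le_two (by nlinarith)

theorem cellWeight_anti (h : s ≤ t) (p : ℕ × X) : cellWeight t p ≤ cellWeight s p := by
  unfold cellWeight
  have : (0 : ℝ) ≤ p.1 := Nat.cast_nonneg _
  exact Real.rpow_le_rpow_of_exponent_le one_le_two (by nlinarith)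

theorem level_lt_of_cellWeight_lt (hs : 0 ≤ s) (h : cellWeight s p < cellWeight s q) :
    q.1 < p.1 := by
  by_contra! h'
  exact absurd (cellWeight_le_of_level_le hs h') (not_le.2 h)

@[simp] theorem cellWeight_zero (p : ℕ × X) : cellWeight 0 p = 1 := by simp [cellWeight]

theorem cellWeight_le_one (hs : 0 ≤ s) (p : ℕ × X) : cellWeight s p ≤ 1 := by
  simpa using cellWeight_anti hs p

theorem cellWeight_one_eq (p : ℕ × X) : cellWeight 1 p = 2⁻¹ ^ p.1 := by
  rw [cellWeight, one_mul, Real.rpow_neg two_pos.le, Real.rpow_natCast, inv_pow]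

theorem cellWeight_eq_rpow (s : ℝ) (p : ℕ × X) : cellWeight s p = (2⁻¹ ^ p.1 : ℝ) ^ s := by
  rw [← cellWeight_one_eq, cellWeight, cellWeight, ← Real.rpow_mul two_pos.le]
  ring_nf

end cellWeight

/-! ### The tree of cells. -/

namespace CellSystem

variable {X : Type*} [PseudoMetricSpace X] (𝒟 : CellSystem X)

/-- The cell of level `p.1` whose distinguished point is `p.2`. -/
def cell (p : ℕ × X) : Set X := {x | 𝒟.rep p.1 x = p.2}

/-- `p` is the index of an actual (nonempty) cell. -/
def IsCell (p : ℕ × X) : Prop := 𝒟.rep p.1 p.2 = p.2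

/-- `p` is a descendant of `q` in the tree of cells. -/
def Sub (p q : ℕ × X) : Prop := q.1 ≤ p.1 ∧ 𝒟.rep q.1 p.2 = q.2

variable {𝒟} {p q r : ℕ × X} {x : X}

theorem isCell_of_mem (h : x ∈ 𝒟.cell p) : 𝒟.IsCell p := by
  change 𝒟.rep p.1 x = p.2 at h
  rw [IsCell, ← h, 𝒟.rep_rep]

theorem isCell_rep (ℓ : ℕ) (x : X) : 𝒟.IsCell (ℓ, 𝒟.rep ℓ x) := 𝒟.rep_rep ℓ x

theorem mem_cell_rep (ℓ : ℕ) (x : X) : x ∈ 𝒟.cell (ℓ, 𝒟.rep ℓ x) := rfl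

theorem IsCell.sub_refl (h : 𝒟.IsCell p) : 𝒟.Sub p p := ⟨le_rfl, h⟩

theorem sub_of_mem (hp : x ∈ 𝒟.cell p) (hq : x ∈ 𝒟.cell q) (h : q.1 ≤ p.1) : 𝒟.Sub p q := by
  refine ⟨h, ?_⟩
  change 𝒟.rep p.1 x = p.2 at hp
  change 𝒟.rep q.1 x = q.2 at hq
  rw [← hq, ← hp]
  exact 𝒟.rep_congr h (𝒟.rep_rep _ _)

theorem Sub.cell_subset (hp : 𝒟.IsCell p) (h : 𝒟.Sub p q) : 𝒟.cell p ⊆ 𝒟.cell q := by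
  intro x hx
  change 𝒟.rep q.1 x = q.2
  rw [← h.2]
  exact 𝒟.rep_congr h.1 ((show 𝒟.rep p.1 x = p.2 from hx).trans hp.symm)

theorem Sub.mem_cell (h : 𝒟.Sub p q) : p.2 ∈ 𝒟.cell q := h.2

theorem Sub.trans (hq : 𝒟.IsCell q) (h : 𝒟.Sub p q) (h' : 𝒟.Sub q r) : 𝒟.Sub p r :=
  ⟨h'.1.trans h.1, h'.cell_subset hq h.mem_cell⟩

theorem Sub.sub_of_level_le (h : 𝒟.Sub p q) (h' : 𝒟.Sub p r) (hqr : r.1 ≤ q.1) : 𝒟.Sub q r :=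
  sub_of_mem h.mem_cell h'.mem_cell hqr

theorem Sub.eq_of_level_eq (h : 𝒟.Sub p q) (h' : 𝒟.Sub p r) (hqr : q.1 = r.1) : q = r := by
  refine Prod.ext hqr ?_
  rw [← h.2, ← h'.2, hqr]

theorem finite_isCell_level_le (𝒟 : CellSystem X) (n : ℕ) :
    {p : ℕ × X | 𝒟.IsCell p ∧ p.1 ≤ n}.Finite := by
  have : {p : ℕ × X | 𝒟.IsCell p ∧ p.1 ≤ n} ⊆
      ⋃ ℓ ∈ Finset.range (n + 1), (fun y => (ℓ, y)) '' Set.range (𝒟.rep ℓ) := by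
    rintro ⟨ℓ, y⟩ ⟨h, hn⟩
    simp only [Finset.mem_range, Set.mem_iUnion]
    exact ⟨ℓ, Nat.lt_succ_of_le hn, y, ⟨y, h⟩, rfl⟩
  exact (Set.Finite.biUnion (Finset.finite_toSet _) fun ℓ _ => (𝒟.finite_range ℓ).image _).subset
    this

theorem countable_isCell (𝒟 : CellSystem X) : {p : ℕ × X | 𝒟.IsCell p}.Countable := by
  have : {p : ℕ × X | 𝒟.IsCell p} = ⋃ n : ℕ, {p : ℕ × X | 𝒟.IsCell p ∧ p.1 ≤ n} := by
    ext p
    simpa using fun _ => ⟨p.1, le_rfl⟩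
  rw [this]
  exact Set.countable_iUnion fun n => (𝒟.finite_isCell_level_le n).countable

/-! ### Net content and good cells. -/

variable (𝒟)

/-- The `s`-dimensional net content. -/
noncomputable def net (s : ℝ) : OuterMeasure X :=
  OuterMeasure.boundedBy fun A =>
    ⨅ (p : ℕ × X) (_ : A ⊆ 𝒟.cell p), ENNReal.ofReal (cellWeight s p)

variable {𝒟}

theorem net_le_cellWeight {s : ℝ} {A : Set X} (h : A ⊆ 𝒟.cell p) :
    𝒟.net s A ≤ ENNReal.ofReal (cellWeight s p) :=
  (OuterMeasure.boundedBy_le _).trans (iInf₂_le p h)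

theorem exists_cover_of_net_lt {s : ℝ} {A : Set X} {c : ℝ≥0∞} (h : 𝒟.net s A < c) :
    ∃ (N : Set ℕ) (p : N → ℕ × X), A ⊆ ⋃ n, 𝒟.cell (p n) ∧
      ∑' n : N, ENNReal.ofReal (cellWeight s (p n)) < c := by
  obtain ⟨c', hc', hcc'⟩ := exists_between h
  rw [net, OuterMeasure.boundedBy_apply] at hc'
  simp only [iInf_lt_iff] at hc'
  obtain ⟨B, hAB, hB⟩ := hc'
  obtain ⟨ε, hε, hεs⟩ := ENNReal.exists_pos_sum_of_countable (tsub_pos_of_lt hcc').ne' ℕ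
  -- Empty pieces cost nothing under `boundedBy`, so only the nonempty ones are assigned a cell;
  -- hence the index set `N`.
  set m : ℕ → ℝ≥0∞ := fun n => ⨆ _ : (B n).Nonempty, ⨅ (p : ℕ × X) (_ : B n ⊆ 𝒟.cell p),
    ENNReal.ofReal (cellWeight s p) with hm
  have key : ∀ n : {n | (B n).Nonempty}, ∃ p : ℕ × X, B n ⊆ 𝒟.cell p ∧
      ENNReal.ofReal (cellWeight s p) ≤ m n + ε n := by
    rintro ⟨n, hn⟩
    have hfin : m n ≠ ∞ := ((ENNReal.le_tsum n).trans_lt (hB.trans_le le_top)).ne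
    have hlt : (⨅ (p : ℕ × X) (_ : B n ⊆ 𝒟.cell p), ENNReal.ofReal (cellWeight s p)) <
        m n + ε n := by
      have hmn : m n = ⨅ (p : ℕ × X) (_ : B n ⊆ 𝒟.cell p), ENNReal.ofReal (cellWeight s p) :=
        iSup_pos hn
      rw [← hmn]
      exact ENNReal.lt_add_right hfin (by simpa using (hε n).ne')
    simp only [iInf_lt_iff] at hlt
    obtain ⟨p, hp, hlt⟩ := hlt
    exact ⟨p, hp, hlt.le⟩
  choose p hp hpε using key
  refine ⟨{n | (B n).Nonempty}, p, ?_, ?_⟩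
  · intro x hx
    obtain ⟨n, hn⟩ := Set.mem_iUnion.1 (hAB hx)
    exact Set.mem_iUnion.2 ⟨⟨n, ⟨x, hn⟩⟩, hp ⟨n, ⟨x, hn⟩⟩ hn⟩
  · calc ∑' n : {n | (B n).Nonempty}, ENNReal.ofReal (cellWeight s (p n))
        ≤ ∑' n : {n | (B n).Nonempty}, (m n + ε n) := ENNReal.tsum_le_tsum fun n => hpε n
      _ ≤ ∑' n : ℕ, (m n + ε n) :=
          ENNReal.tsum_comp_le_tsum_of_injective Subtype.val_injective fun n => m n + (ε n : ℝ≥0∞)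
      _ ≤ c' + ∑' n, (ε n : ℝ≥0∞) := by
          rw [ENNReal.tsum_add]
          exact add_le_add_left hB.le _
      _ < c := by
          have := ENNReal.add_lt_add_left (hcc'.trans_le le_top).ne hεs
          rwa [add_tsub_cancel_of_le hcc'.le] at this

variable (𝒟)

/-- A cell whose `t`-dimensional content is comparable to the one its scale allows. -/
def Good (t : ℝ) (p : ℕ × X) : Prop :=
  𝒟.IsCell p ∧ ENNReal.ofReal (cellWeight t p) ≤ 2 * 𝒟.net t (𝒟.cell p)

/-- The points that lie in no good cell of level at least `L`. -/
def badSet (t : ℝ) (L : ℕ) : Set X := {x | ∀ ℓ, L ≤ ℓ → ¬ 𝒟.Good t (ℓ, 𝒟.rep ℓ x)}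

variable {𝒟}

/-- A cell of level at least `L` that meets the bad set is not good, so other cells cover it with
less than half its weight. Each of these weighs less, hence is deeper, and the argument repeats
inside it; every round gains a factor 1/2. -/
theorem net_badSet_inter_cell_le {t : ℝ} (ht : 0 < t) (L k : ℕ) (hL : L ≤ p.1) :
    𝒟.net t (𝒟.badSet t L ∩ 𝒟.cell p) ≤ 2⁻¹ ^ k * ENNReal.ofReal (cellWeight t p) := by
  induction k generalizing p with
  | zero => simpa using net_le_cellWeight Set.inter_subset_right
  | succ k ih =>
    rcases (𝒟.badSet t L ∩ 𝒟.cell p).eq_empty_or_nonempty with h | ⟨x, hx, hxp⟩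
    · simp [h]
    have hbad : ¬ 𝒟.Good t p := by
      have := hx p.1 hL
      rwa [show 𝒟.rep p.1 x = p.2 from hxp] at this
    have hnet : 𝒟.net t (𝒟.cell p) < 2⁻¹ * ENNReal.ofReal (cellWeight t p) := by
      by_contra! h
      refine hbad ⟨isCell_of_mem hxp, ?_⟩
      calc ENNReal.ofReal (cellWeight t p) = 2 * (2⁻¹ * ENNReal.ofReal (cellWeight t p)) := by
            rw [← mul_assoc, ENNReal.mul_inv_cancel two_ne_zero ENNReal.ofNat_ne_top, one_mul]
        _ ≤ _ := by gcongr
    obtain ⟨N, u, hu, hsum⟩ := exists_cover_of_net_lt hnet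
    have hlev : ∀ n, L ≤ (u n).1 := by
      intro n
      refine hL.trans (level_lt_of_cellWeight_lt ht.le (p := u n) (q := p) ?_).le
      have h1 : ENNReal.ofReal (cellWeight t (u n)) < ENNReal.ofReal (cellWeight t p) :=
        (ENNReal.le_tsum n).trans_lt
          (hsum.trans_le (mul_le_of_le_one_left' (by simp)))
      exact (ENNReal.ofReal_lt_ofReal_iff (cellWeight_pos _ _)).1 h1
    calc 𝒟.net t (𝒟.badSet t L ∩ 𝒟.cell p)
        ≤ 𝒟.net t (⋃ n, 𝒟.badSet t L ∩ 𝒟.cell (u n)) := by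
          apply measure_mono
          rintro y ⟨hy, hyp⟩
          obtain ⟨n, hyn⟩ := Set.mem_iUnion.1 (hu hyp)
          exact Set.mem_iUnion.2 ⟨n, hy, hyn⟩
      _ ≤ ∑' n : N, 𝒟.net t (𝒟.badSet t L ∩ 𝒟.cell (u n)) :=
          measure_iUnion_le _
      _ ≤ ∑' n : N, 2⁻¹ ^ k * ENNReal.ofReal (cellWeight t (u n)) :=
          ENNReal.tsum_le_tsum fun n => ih (hlev n)
      _ ≤ 2⁻¹ ^ k * (2⁻¹ * ENNReal.ofReal (cellWeight t p)) := by
          rw [ENNReal.tsum_mul_left]; gcongr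
      _ = _ := by rw [pow_succ, mul_assoc]

theorem net_badSet {t : ℝ} (ht : 0 < t) (L : ℕ) : 𝒟.net t (𝒟.badSet t L) = 0 := by
  have hcell : ∀ p : ℕ × X, L ≤ p.1 → 𝒟.net t (𝒟.badSet t L ∩ 𝒟.cell p) = 0 := by
    intro p hp
    have h1 : Tendsto (fun k : ℕ => (2⁻¹ : ℝ≥0∞) ^ k * ENNReal.ofReal (cellWeight t p)) atTop
        (𝓝 (0 * ENNReal.ofReal (cellWeight t p))) :=
      ENNReal.Tendsto.mul_const (ENNReal.tendsto_pow_atTop_nhds_zero_of_lt_one (by simp))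
        (Or.inr ENNReal.ofReal_ne_top)
    rw [zero_mul] at h1
    exact le_antisymm (ge_of_tendsto' h1 fun k => net_badSet_inter_cell_le ht L k hp) bot_le
  have hsub : 𝒟.badSet t L ⊆ ⋃ y ∈ Set.range (𝒟.rep L), 𝒟.badSet t L ∩ 𝒟.cell (L, y) :=
    fun x hx => Set.mem_iUnion₂.2 ⟨_, ⟨x, rfl⟩, hx, rfl⟩
  refine measure_mono_null hsub ?_
  rw [measure_biUnion_null_iff (𝒟.finite_range L).countable]
  exact fun y _ => hcell _ le_rfl

theorem dist_le_of_mem_cell {x y : X} (hx : x ∈ 𝒟.cell p) (hy : y ∈ 𝒟.cell p) :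
    dist x y ≤ 2 * 𝒟.C * 2⁻¹ ^ p.1 := by
  have h1 := 𝒟.dist_rep p.1 x
  have h2 := 𝒟.dist_rep p.1 y
  rw [show 𝒟.rep p.1 x = p.2 from hx] at h1
  rw [show 𝒟.rep p.1 y = p.2 from hy] at h2
  linarith [dist_triangle_right x y p.2]

theorem C_nonneg (𝒟 : CellSystem X) (x : X) : 0 ≤ 𝒟.C := by
  simpa using dist_nonneg.trans (𝒟.dist_rep 0 x)

end CellSystem

/-! ### Existence of good cells. -/

namespace CellSystem

variable {X : Type*} [MetricSpace X] {𝒟 : CellSystem X} {p q r : ℕ × X} {x : X}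

theorem ediam_cell_rpow_le {t : ℝ} (ht : 0 < t) (p : ℕ × X) :
    Metric.ediam (𝒟.cell p) ^ t ≤ ENNReal.ofReal ((2 * 𝒟.C) ^ t) * ENNReal.ofReal (cellWeight t p) := by
  rcases (𝒟.cell p).eq_empty_or_nonempty with h | ⟨x, -⟩
  · simp [h, ht]
  have hC := 𝒟.C_nonneg x
  have h1 : Metric.ediam (𝒟.cell p) ≤ ENNReal.ofReal (2 * 𝒟.C * 2⁻¹ ^ p.1) := by
    refine Metric.ediam_le fun x hx y hy => ?_
    rw [edist_dist]
    exact ENNReal.ofReal_le_ofReal (dist_le_of_mem_cell hx hy)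
  calc Metric.ediam (𝒟.cell p) ^ t ≤ ENNReal.ofReal (2 * 𝒟.C * 2⁻¹ ^ p.1) ^ t :=
        ENNReal.rpow_le_rpow h1 ht.le
    _ = _ := by
        rw [ENNReal.ofReal_rpow_of_nonneg (by positivity) ht.le,
          Real.mul_rpow (by positivity) (by positivity), ← cellWeight_eq_rpow,
          ENNReal.ofReal_mul (by positivity)]

/-- The content puts no bound on the size of the covering cells, but a cover of total weight below
`2⁻ᵏᵗ` uses only cells of level above `k`. Small content thus forces small diameters. -/
theorem hausdorffMeasure_eq_zero_of_net_eq_zero [MeasurableSpace X] [BorelSpace X] {t : ℝ}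
    (ht : 0 < t) {A : Set X} (h : 𝒟.net t A = 0) : μH[t] A = 0 := by
  rcases A.eq_empty_or_nonempty with rfl | ⟨x₀, -⟩
  · simp
  have hC := 𝒟.C_nonneg x₀
  have key : ∀ k : ℕ, ∃ (N : Set ℕ) (p : N → ℕ × X), A ⊆ ⋃ n, 𝒟.cell (p n) ∧
      ∑' n : N, ENNReal.ofReal (cellWeight t (p n)) < ENNReal.ofReal (cellWeight t (k, x₀)) :=
    fun k => exists_cover_of_net_lt (by rw [h]; exact ENNReal.ofReal_pos.2 (cellWeight_pos _ _))
  choose N p hA hsum using key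
  have hlim1 : Tendsto (fun k : ℕ => ENNReal.ofReal (2 * 𝒟.C * 2⁻¹ ^ k)) atTop (𝓝 0) := by
    have : Tendsto (fun k : ℕ => 2 * 𝒟.C * (2⁻¹ : ℝ) ^ k) atTop (𝓝 (2 * 𝒟.C * 0)) :=
      (tendsto_pow_atTop_nhds_zero_of_lt_one (by norm_num) (by norm_num)).const_mul _
    simpa using ENNReal.tendsto_ofReal this
  have hlim2 : Tendsto (fun k : ℕ => ENNReal.ofReal ((2 * 𝒟.C) ^ t) *
      ENNReal.ofReal (cellWeight t (k, x₀))) atTop (𝓝 0) := by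
    have h1 : Tendsto (fun k : ℕ => (2 * 𝒟.C) ^ t * ((2⁻¹ : ℝ) ^ t) ^ k) atTop
        (𝓝 ((2 * 𝒟.C) ^ t * 0)) :=
      (tendsto_pow_atTop_nhds_zero_of_lt_one (by positivity)
        (Real.rpow_lt_one (by norm_num) (by norm_num) ht)).const_mul _
    have h2 := ENNReal.tendsto_ofReal h1
    simp only [mul_zero, ENNReal.ofReal_zero] at h2
    refine h2.congr fun k => ?_
    rw [ENNReal.ofReal_mul (by positivity), cellWeight_eq_rpow, ← Real.rpow_natCast,
      ← Real.rpow_natCast, ← Real.rpow_mul (by norm_num), ← Real.rpow_mul (by norm_num), mul_comm t]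
  have hlev : ∀ k n, k < (p k n).1 := fun k n =>
    level_lt_of_cellWeight_lt (p := p k n) (q := (k, x₀)) ht.le <|
      (ENNReal.ofReal_lt_ofReal_iff (cellWeight_pos _ _)).1 ((ENNReal.le_tsum n).trans_lt (hsum k))
  have h3 := Measure.hausdorffMeasure_le_liminf_tsum t A
    (fun k : ℕ => ENNReal.ofReal (2 * 𝒟.C * 2⁻¹ ^ k)) hlim1 (fun k (n : N k) => 𝒟.cell (p k n))
    (Eventually.of_forall fun k n => Metric.ediam_le fun x hx y hy => by
      rw [edist_dist]
      refine ENNReal.ofReal_le_ofReal ((dist_le_of_mem_cell hx hy).trans ?_)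
      gcongr ?_ * ?_
      exact pow_le_pow_of_le_one (by norm_num) (by norm_num) (hlev k n).le)
    (Eventually.of_forall hA)
  refine le_antisymm (h3.trans ?_) bot_le
  rw [← hlim2.liminf_eq]
  refine liminf_le_liminf (Eventually.of_forall fun k => ?_)
  calc ∑' n, Metric.ediam (𝒟.cell (p k n)) ^ t
      ≤ ∑' n, ENNReal.ofReal ((2 * 𝒟.C) ^ t) * ENNReal.ofReal (cellWeight t (p k n)) :=
        ENNReal.tsum_le_tsum fun n => ediam_cell_rpow_le ht _
    _ ≤ _ := by rw [ENNReal.tsum_mul_left]; gcongr; exact (hsum k).le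

theorem exists_good [MeasurableSpace X] [BorelSpace X] {t : ℝ} (ht : 0 < t)
    (h : μH[t] (Set.univ : Set X) ≠ 0) : ∃ p, 𝒟.Good t p := by
  by_contra! hbad
  refine h (hausdorffMeasure_eq_zero_of_net_eq_zero (𝒟 := 𝒟) ht ?_)
  rw [← net_badSet (𝒟 := 𝒟) ht 0]
  congr 1
  exact (Set.eq_univ_of_forall fun x ℓ _ => hbad _).symm

/-! ### Spread families inside a good cell. -/

open Classical in
theorem pairwiseDisjoint_filter_sub {𝓐 : Set (ℕ × X)}
    (h : ∀ R ∈ 𝓐, ∀ R' ∈ 𝓐, 𝒟.Sub R R' → R' = R) (F : Finset (ℕ × X)) :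
    𝓐.PairwiseDisjoint fun R => F.filter (𝒟.Sub · R) := by
  intro R hR R' hR' hne
  refine Finset.disjoint_left.2 fun p hp hp' => hne ?_
  rw [Finset.mem_filter] at hp hp'
  rcases le_total R.1 R'.1 with hl | hl
  · exact h _ hR' _ hR (hp'.2.sub_of_level_le hp.2 hl)
  · exact (h _ hR _ hR' (hp.2.sub_of_level_le hp'.2 hl)).symm

open Classical in
/-- A set of subcells of `Q`, maximal for the condition that every cell `R` inside `Q` satisfies
`∑ wt p ≤ 2 wt R` over the `p` inside `R`, saturates a cell above each candidate. -/
theorem exists_saturating (𝒞 : Set (ℕ × X)) (α : ℝ) (Q : ℕ × X) (hα : 0 ≤ α)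
    (h𝒞 : ∀ p ∈ 𝒞, 𝒟.IsCell p ∧ 𝒟.Sub p Q) :
    ∃ S ⊆ 𝒞, (∀ F : Finset (ℕ × X), ↑F ⊆ S → ∀ R, 𝒟.IsCell R → 𝒟.Sub R Q →
        ∑ p ∈ F with 𝒟.Sub p R, cellWeight α p ≤ 2 * cellWeight α R) ∧
      ∀ p ∈ 𝒞, ∃ R, 𝒟.IsCell R ∧ 𝒟.Sub R Q ∧ 𝒟.Sub p R ∧ ∃ F : Finset (ℕ × X), ↑F ⊆ S ∧
        cellWeight α R ≤ ∑ p ∈ F with 𝒟.Sub p R, cellWeight α p := by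
  let 𝔽 : Set (Set (ℕ × X)) := {S | S ⊆ 𝒞 ∧ ∀ F : Finset (ℕ × X), ↑F ⊆ S → ∀ R, 𝒟.IsCell R →
    𝒟.Sub R Q → ∑ p ∈ F with 𝒟.Sub p R, cellWeight α p ≤ 2 * cellWeight α R}
  -- The constraint only involves finite subfamilies, so the Teichmüller–Tukey lemma supplies a
  -- maximal one.
  have hchar : Order.IsOfFiniteCharacter 𝔽 := by
    refine fun S => ⟨fun hS y hy _ => ⟨hy.trans hS.1, fun F hF => hS.2 F (hF.trans hy)⟩,
      fun hS => ⟨fun p hp => ?_, fun F hF => ?_⟩⟩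
    · exact (hS {p} (by simpa using hp) (Set.finite_singleton p)).1 rfl
    · exact (hS F hF F.finite_toSet).2 F le_rfl
  have hempty : (∅ : Set (ℕ × X)) ∈ 𝔽 := by
    refine ⟨Set.empty_subset _, fun F hF R _ _ => ?_⟩
    have : F = ∅ := by simpa using hF
    simp [this, (cellWeight_pos α R).le]
  obtain ⟨S, -, hS⟩ := hchar.exists_maximal hempty
  refine ⟨S, hS.prop.1, hS.prop.2, fun p hp => ?_⟩
  by_cases hpS : p ∈ S
  · refine ⟨p, (h𝒞 p hp).1, (h𝒞 p hp).2, (h𝒞 p hp).1.sub_refl, {p}, by simpa using hpS, ?_⟩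
    rw [Finset.filter_true_of_mem (by simpa using (h𝒞 p hp).1.sub_refl)]
    simp
  have hins : insert p S ∉ 𝔽 := fun h =>
    hpS (hS.le_of_ge h (Set.subset_insert p S) (Set.mem_insert p S))
  -- Adding `p` breaks the bound at some `R`, necessarily above `p`. As `p` weighs at most as much
  -- as `R`, removing it from a sum above `2 wt R` leaves at least `wt R`; this is the reason for
  -- the constant 2.
  have hex : ∃ F : Finset (ℕ × X), ↑F ⊆ insert p S ∧ ∃ R, 𝒟.IsCell R ∧ 𝒟.Sub R Q ∧
      2 * cellWeight α R < ∑ p ∈ F with 𝒟.Sub p R, cellWeight α p := by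
    by_contra! h
    exact hins ⟨Set.insert_subset hp hS.prop.1, h⟩
  obtain ⟨F, hF, R, hR, hRQ, hlt⟩ := hex
  have hF' : ((F.erase p : Finset (ℕ × X)) : Set (ℕ × X)) ⊆ S := by
    intro q hq
    rw [Finset.coe_erase] at hq
    exact (hF hq.1).resolve_left hq.2
  have hle := hS.prop.2 _ hF' R hR hRQ
  rw [Finset.filter_erase] at hle
  have hpF : p ∈ F.filter (𝒟.Sub · R) := by
    by_contra h
    rw [Finset.erase_eq_of_notMem h] at hle
    linarith
  have hpR : 𝒟.Sub p R := (Finset.mem_filter.1 hpF).2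
  refine ⟨R, hR, hRQ, hpR, F.erase p, hF', ?_⟩
  rw [Finset.filter_erase]
  have := Finset.sum_erase_add _ (cellWeight α) hpF
  have := cellWeight_le_of_level_le hα hpR.1
  linarith

variable (𝒟) in
open Classical in
/-- A finite antichain of good subcells of `Q` whose `α`-dimensional weight is spread over `Q` as
evenly as the `α`-dimensional scale of the cells allows. -/
structure IsSpread (t α : ℝ) (Q : ℕ × X) (L : ℕ) (S : Finset (ℕ × X)) : Prop where
  good : ∀ p ∈ S, 𝒟.Good t p
  sub : ∀ p ∈ S, 𝒟.Sub p Q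
  level : ∀ p ∈ S, L ≤ p.1
  antichain : ∀ p ∈ S, ∀ q ∈ S, 𝒟.Sub p q → q = p
  sum_le : ∀ R, 𝒟.IsCell R → 𝒟.Sub R Q →
    ∑ p ∈ S with 𝒟.Sub p R, cellWeight α p ≤ 2 * cellWeight α R
  le_sum : cellWeight α Q ≤ 8 * ∑ p ∈ S, cellWeight α p

open Classical in
theorem exists_maximal_above {𝓡 : Set (ℕ × X)} (h𝓡 : ∀ R ∈ 𝓡, 𝒟.IsCell R) {R : ℕ × X}
    (hR : R ∈ 𝓡) : ∃ R' ∈ 𝓡, 𝒟.Sub R R' ∧ ∀ R'' ∈ 𝓡, 𝒟.Sub R' R'' → R'' = R' := by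
  have hex : ∃ k, ∃ R' ∈ 𝓡, 𝒟.Sub R R' ∧ R'.1 = k := ⟨_, R, hR, (h𝓡 R hR).sub_refl, rfl⟩
  obtain ⟨R', hR', hRR', hk⟩ := Nat.find_spec hex
  refine ⟨R', hR', hRR', fun R'' hR'' h => ?_⟩
  have h1 : 𝒟.Sub R R'' := hRR'.trans (h𝓡 _ hR') h
  have h2 : R'.1 ≤ R''.1 := hk ▸ Nat.find_min' hex ⟨R'', hR'', h1, rfl⟩
  exact h1.eq_of_level_eq hRR' (le_antisymm h.1 h2)

open Classical in
-- Up to a net-null set, every point of `Q` lies in a good candidate, hence in a saturated cell. The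
-- maximal saturated cells therefore carry a definite share of the `t`-weight of `Q`, and saturation
-- turns their `α`-weight into weight of the family.
theorem exists_isSpread {t α : ℝ} (hα : 0 < α) (hαt : α ≤ t) {Q : ℕ × X} (hQ : 𝒟.Good t Q)
    (L : ℕ) : ∃ S, 𝒟.IsSpread t α Q L S := by
  have ht : 0 < t := hα.trans_le hαt
  obtain ⟨S, hS𝒞, hSle, hsat⟩ := exists_saturating (𝒟 := 𝒟)
    {p | 𝒟.Good t p ∧ 𝒟.Sub p Q ∧ L ≤ p.1} α Q hα.le fun p hp => ⟨hp.1.1, hp.2.1⟩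
  let 𝓡 : Set (ℕ × X) := {R | 𝒟.IsCell R ∧ 𝒟.Sub R Q ∧ ∃ F : Finset (ℕ × X), ↑F ⊆ S ∧
        cellWeight α R ≤ ∑ p ∈ F with 𝒟.Sub p R, cellWeight α p}
  let 𝓜 : Set (ℕ × X) := {R | R ∈ 𝓡 ∧ ∀ R' ∈ 𝓡, 𝒟.Sub R R' → R' = R}
  have h𝓜 : ∀ R ∈ 𝓜, ∀ R' ∈ 𝓜, 𝒟.Sub R R' → R' = R := fun R hR R' hR' => hR.2 R' hR'.1
  have hcover : 𝒟.cell Q ⊆ 𝒟.badSet t (max L Q.1) ∪ ⋃ R ∈ 𝓜, 𝒟.cell R := by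
    intro x hx
    by_cases hxb : x ∈ 𝒟.badSet t (max L Q.1)
    · exact Or.inl hxb
    right
    simp only [badSet, Set.mem_ofPred_eq, not_forall, not_not] at hxb
    obtain ⟨ℓ, hℓ, hgood⟩ := hxb
    have hsub : 𝒟.Sub (ℓ, 𝒟.rep ℓ x) Q :=
      sub_of_mem (mem_cell_rep ℓ x) hx ((le_max_right _ _).trans hℓ)
    obtain ⟨R, hR, hRQ, hpR, hF⟩ := hsat _ ⟨hgood, hsub, (le_max_left _ _).trans hℓ⟩
    obtain ⟨R', hR', hRR', hmax⟩ := exists_maximal_above (𝓡 := 𝓡) (fun R hR => hR.1)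
      (R := R) ⟨hR, hRQ, hF⟩
    exact Set.mem_iUnion₂.2 ⟨R', ⟨hR', hmax⟩,
      hRR'.cell_subset hR (hpR.cell_subset hgood.1 (mem_cell_rep ℓ x))⟩
  have h𝓜c : 𝓜.Countable := 𝒟.countable_isCell.mono fun R hR => hR.1.1
  have hnet : 𝒟.net t (𝒟.cell Q) ≤ ∑' R : 𝓜, ENNReal.ofReal (cellWeight t (R : ℕ × X)) := by
    calc 𝒟.net t (𝒟.cell Q)
        ≤ 𝒟.net t (𝒟.badSet t (max L Q.1)) + 𝒟.net t (⋃ R ∈ 𝓜, 𝒟.cell R) :=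
          (measure_mono hcover).trans (measure_union_le _ _)
      _ ≤ 0 + ∑' R : 𝓜, 𝒟.net t (𝒟.cell R) := by
          rw [net_badSet ht]
          gcongr
          exact measure_biUnion_le _ h𝓜c _
      _ ≤ _ := by
          rw [zero_add]
          exact ENNReal.tsum_le_tsum fun R => net_le_cellWeight le_rfl
  -- Goodness of `Q` gives half of its weight; a further factor 2 makes the inequality strict, so
  -- that a finite subfamily attains it.
  have hlt : ENNReal.ofReal (cellWeight t Q / 4) < ∑' R : 𝓜, ENNReal.ofReal (cellWeight t (R : ℕ × X)) := by
    have hpos := cellWeight_pos t Q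
    by_contra! h
    have h2 : ENNReal.ofReal (cellWeight t Q) ≤ ENNReal.ofReal (2 * (cellWeight t Q / 4)) := by
      rw [ENNReal.ofReal_mul two_pos.le, ENNReal.ofReal_ofNat]
      exact hQ.2.trans (by gcongr; exact hnet.trans h)
    rw [ENNReal.ofReal_le_ofReal_iff (by positivity)] at h2
    linarith
  rw [ENNReal.tsum_eq_iSup_sum, lt_iSup_iff] at hlt
  obtain ⟨G, hG⟩ := hlt
  rw [← ENNReal.ofReal_sum_of_nonneg fun R _ => (cellWeight_pos t R.1).le,
    ENNReal.ofReal_lt_ofReal_iff_of_nonneg (by have := cellWeight_pos t Q; positivity)] at hG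
  choose F hFS hF using fun R : 𝓜 => R.2.1.2.2
  let H : Finset (ℕ × X) := G.biUnion F
  have hHS : (H : Set (ℕ × X)) ⊆ S := by
    intro p hp
    obtain ⟨R, -, hp⟩ := Finset.mem_biUnion.1 (Finset.mem_coe.1 hp)
    exact hFS R hp
  have hHsum : cellWeight α Q ≤ 4 * ∑ p ∈ H, cellWeight α p := by
    have h1 : ∑ R ∈ G, cellWeight α (R : ℕ × X) ≤ ∑ p ∈ H, cellWeight α p := by
      have hdisj : (G : Set 𝓜).PairwiseDisjoint fun R : 𝓜 => H.filter (𝒟.Sub · R) :=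
        fun R _ R' _ hne => pairwiseDisjoint_filter_sub h𝓜 H R.2 R'.2 fun h => hne (Subtype.ext h)
      calc ∑ R ∈ G, cellWeight α (R : ℕ × X)
          ≤ ∑ R ∈ G, ∑ p ∈ H with 𝒟.Sub p R, cellWeight α p := by
            refine Finset.sum_le_sum fun R hR => (hF R).trans ?_
            exact Finset.sum_le_sum_of_subset_of_nonneg
              (Finset.filter_subset_filter _ (Finset.subset_biUnion_of_mem F hR))
              fun p _ _ => (cellWeight_pos α p).le
        _ = ∑ p ∈ G.biUnion fun R : 𝓜 => H.filter (𝒟.Sub · R), cellWeight α p :=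
            (Finset.sum_biUnion hdisj).symm
        _ ≤ _ := Finset.sum_le_sum_of_subset_of_nonneg
            (Finset.biUnion_subset.2 fun R _ => Finset.filter_subset _ _)
            fun p _ _ => (cellWeight_pos α p).le
    -- As `α ≤ t`, a cell inside `Q` has a larger relative weight for the exponent `α` than for `t`.
    have h2 : (cellWeight α Q / cellWeight t Q) * ∑ R ∈ G, cellWeight t (R : ℕ × X) ≤
        ∑ R ∈ G, cellWeight α (R : ℕ × X) := by
      rw [Finset.mul_sum]
      refine Finset.sum_le_sum fun R _ => ?_
      have h3 : cellWeight (t - α) (R : ℕ × X) ≤ cellWeight (t - α) Q :=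
        cellWeight_le_of_level_le (by linarith) R.2.1.2.1.1
      rw [cellWeight_sub, cellWeight_sub,
        div_le_div_iff₀ (cellWeight_pos _ _) (cellWeight_pos _ _)] at h3
      rw [div_mul_eq_mul_div, div_le_iff₀ (cellWeight_pos _ _)]
      linarith
    have h4 : cellWeight α Q = (cellWeight α Q / cellWeight t Q) * (4 * (cellWeight t Q / 4)) := by
      have := (cellWeight_pos t Q).ne'
      field_simp
    have h5 : (cellWeight α Q / cellWeight t Q) * (cellWeight t Q / 4) ≤
        (cellWeight α Q / cellWeight t Q) * ∑ R ∈ G, cellWeight t (R : ℕ × X) :=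
      mul_le_mul_of_nonneg_left hG.le (div_pos (cellWeight_pos _ _) (cellWeight_pos _ _)).le
    linarith
  -- Keeping only the outermost cells loses a factor 2, by the constraint applied at each of them;
  -- with the earlier 4 this makes 8.
  let T : Finset (ℕ × X) := H.filter fun p => ∀ q ∈ H, 𝒟.Sub p q → q = p
  have hTH : T ⊆ H := Finset.filter_subset _ _
  have hTS : (T : Set (ℕ × X)) ⊆ S := (Finset.coe_subset.2 hTH).trans hHS
  have hTanti : ∀ p ∈ T, ∀ q ∈ T, 𝒟.Sub p q → q = p :=
    fun p hp q hq => (Finset.mem_filter.1 hp).2 q (hTH hq)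
  refine ⟨T, fun p hp => (hS𝒞 (hTS hp)).1, fun p hp => (hS𝒞 (hTS hp)).2.1,
    fun p hp => (hS𝒞 (hTS hp)).2.2, hTanti, hSle T hTS, hHsum.trans ?_⟩
  have h1 : ∑ p ∈ H, cellWeight α p ≤ ∑ q ∈ T, ∑ p ∈ H with 𝒟.Sub p q, cellWeight α p := by
    rw [← Finset.sum_biUnion (pairwiseDisjoint_filter_sub (𝓐 := (T : Set (ℕ × X))) hTanti H)]
    refine Finset.sum_le_sum_of_subset_of_nonneg (fun p hp => ?_)
      fun p _ _ => (cellWeight_pos α p).le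
    obtain ⟨q, hq, hpq, hmax⟩ := exists_maximal_above (𝒟 := 𝒟) (𝓡 := (H : Set (ℕ × X)))
      (fun R hR => (hS𝒞 (hHS hR)).1.1) hp
    exact Finset.mem_biUnion.2 ⟨q, Finset.mem_filter.2 ⟨hq, hmax⟩, Finset.mem_filter.2 ⟨hp, hpq⟩⟩
  have h2 : ∑ q ∈ T, ∑ p ∈ H with 𝒟.Sub p q, cellWeight α p ≤ ∑ q ∈ T, 2 * cellWeight α q :=
    Finset.sum_le_sum fun q hq => hSle H hHS q (hS𝒞 (hTS hq)).1.1 (hS𝒞 (hTS hq)).2.1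
  rw [← Finset.mul_sum] at h2
  linarith

end CellSystem

theorem exists_level_cellWeight_lt {X : Type*} {s δ : ℝ} (hs : 0 < s) (hδ : 0 < δ) (n : ℕ) :
    ∃ L, n ≤ L ∧ ∀ p : ℕ × X, L ≤ p.1 → cellWeight s p < δ := by
  have h1 : Tendsto (fun k : ℕ => ((2⁻¹ : ℝ) ^ s) ^ k) atTop (𝓝 0) :=
    tendsto_pow_atTop_nhds_zero_of_lt_one (by positivity)
      (Real.rpow_lt_one (by norm_num) (by norm_num) hs)
  obtain ⟨L, hL, hn⟩ := ((h1.eventually_lt_const hδ).and (eventually_ge_atTop n)).exists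
  refine ⟨L, hn, fun p hp => (cellWeight_le_of_level_le (q := (L, p.2)) hs.le hp).trans_lt ?_⟩
  rwa [cellWeight_eq_rpow, ← Real.rpow_natCast, ← Real.rpow_mul (by norm_num), mul_comm,
    Real.rpow_mul (by norm_num), Real.rpow_natCast]

/-- Finitely many families of bounded total weight are simultaneously charged by one probability
measure, up to a constant. -/
theorem exists_probabilityMeasure_le {X ι : Type*} [MeasurableSpace X] (J : Finset ι) (S : ι → Finset (ℕ × X))
    (w : ι → ℕ × X → ℝ) (hw : ∀ j p, 0 ≤ w j p) (hsum : ∀ j ∈ J, ∑ p ∈ S j, w j p ≤ 2)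
    (x₀ : X) : ∃ π : ProbabilityMeasure X, ∀ j ∈ J, ∀ p ∈ S j, ∀ U : Set X, p.2 ∈ U →
      ENNReal.ofReal (w j p / (2 * J.card + 1)) ≤ (π : Measure X) U := by
  -- The extra point mass keeps `ρ` nonzero even when there is no family to charge.
  let ρ : Measure X := (∑ j ∈ J, ∑ p ∈ S j, ENNReal.ofReal (w j p) • Measure.dirac p.2) +
    Measure.dirac x₀
  have hρ1 : 1 ≤ ρ Set.univ := by simp [ρ]
  have hρ2 : ρ Set.univ ≤ ENNReal.ofReal (2 * J.card + 1) := by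
    have h1 : ρ Set.univ = ENNReal.ofReal (∑ j ∈ J, ∑ p ∈ S j, w j p) + 1 := by
      simp only [ρ, Measure.add_apply, Measure.finsetSum_apply, Measure.smul_apply, measure_univ,
        smul_eq_mul, mul_one]
      rw [ENNReal.ofReal_sum_of_nonneg fun j _ => Finset.sum_nonneg fun p _ => hw j p]
      simp_rw [ENNReal.ofReal_sum_of_nonneg fun p _ => hw _ p]
    rw [h1, ← ENNReal.ofReal_one, ← ENNReal.ofReal_add
      (Finset.sum_nonneg fun j _ => Finset.sum_nonneg fun p _ => hw j p) zero_le_one]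
    refine ENNReal.ofReal_le_ofReal ?_
    have := Finset.sum_le_sum hsum
    rw [Finset.sum_const, nsmul_eq_mul] at this
    linarith
  have hfin : ρ Set.univ ≠ ∞ := ne_top_of_le_ne_top ENNReal.ofReal_ne_top hρ2
  have hne : ρ Set.univ ≠ 0 := (zero_lt_one.trans_le hρ1).ne'
  refine ⟨⟨(ρ Set.univ)⁻¹ • ρ, ⟨by simp [ENNReal.inv_mul_cancel hne hfin]⟩⟩,
    fun j hj p hp U hpU => ?_⟩
  change _ ≤ (ρ Set.univ)⁻¹ * ρ U
  have h3 : ENNReal.ofReal (w j p) ≤ ρ U := by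
    calc ENNReal.ofReal (w j p) = (ENNReal.ofReal (w j p) • Measure.dirac p.2 : Measure X) U := by
          simp [Measure.dirac_apply_of_mem hpU]
      _ ≤ ∑ p ∈ S j, (ENNReal.ofReal (w j p) • Measure.dirac p.2 : Measure X) U :=
          Finset.single_le_sum
            (f := fun p => (ENNReal.ofReal (w j p) • Measure.dirac p.2 : Measure X) U)
            (fun _ _ => bot_le) hp
      _ ≤ ∑ j ∈ J, ∑ p ∈ S j, (ENNReal.ofReal (w j p) • Measure.dirac p.2 : Measure X) U :=
          Finset.single_le_sum
            (f := fun j => ∑ p ∈ S j, (ENNReal.ofReal (w j p) • Measure.dirac p.2 : Measure X) U)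
            (fun _ _ => bot_le) hj
      _ ≤ ρ U := by
          simp only [ρ, Measure.add_apply, Measure.finsetSum_apply]
          exact le_self_add
  rw [ENNReal.ofReal_div_of_pos (by positivity), div_eq_mul_inv, mul_comm]
  gcongr

/-! ### Open and dense sets of probability measures. -/

section ProbabilityMeasure

variable {X : Type*} [MetricSpace X] [MeasurableSpace X] [BorelSpace X]

theorem isOpen_setOf_lt_measure {U : Set X} (hU : IsOpen U) (c : ℝ≥0∞) :
    IsOpen {μ : ProbabilityMeasure X | c < (μ : Measure X) U} := by
  rw [isOpen_iff_mem_nhds]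
  intro μ hμ
  have h := ProbabilityMeasure.le_liminf_measure_open_of_tendsto (tendsto_id (x := 𝓝 μ)) hU
  exact eventually_lt_of_lt_liminf (lt_of_lt_of_le hμ h)

/-- The convex combination `(1 - ε) ν + ε π`. -/
noncomputable def ProbabilityMeasure.mix (ε : ℝ) (hε : ε ∈ Set.Icc (0 : ℝ) 1)
    (ν π : ProbabilityMeasure X) : ProbabilityMeasure X :=
  ⟨ENNReal.ofReal (1 - ε) • (ν : Measure X) + ENNReal.ofReal ε • (π : Measure X), ⟨by
    have h1 : 0 ≤ 1 - ε := by linarith [hε.2]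
    simp [← ENNReal.ofReal_add h1 hε.1]⟩⟩

/-- With `ε = 1 / (k + 1)` the mixtures converge weakly to `ν` whatever the `π k` are, because the
integrals of a bounded function against them stay bounded. -/
theorem dense_of_forall_mix_mem {U : Set (ProbabilityMeasure X)}
    (h : ∀ (ν : ProbabilityMeasure X) (ε : ℝ) (hε : ε ∈ Set.Icc (0 : ℝ) 1), 0 < ε →
      ∃ π, ProbabilityMeasure.mix ε hε ν π ∈ U) : Dense U := by
  intro ν
  have hε : ∀ k : ℕ, (1 / ((k : ℝ) + 1)) ∈ Set.Icc (0 : ℝ) 1 := fun k =>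
    ⟨by positivity, by rw [div_le_one (by positivity)]; linarith [(k.cast_nonneg : (0 : ℝ) ≤ k)]⟩
  choose π hπ using fun k : ℕ => h ν _ (hε k) (by positivity)
  refine mem_closure_of_tendsto (b := atTop) ?_ (Eventually.of_forall hπ)
  rw [ProbabilityMeasure.tendsto_iff_forall_integral_tendsto]
  intro f
  have hint : ∀ k, ∫ x, f x ∂(ProbabilityMeasure.mix _ (hε k) ν (π k) : Measure X) =
      (1 - 1 / ((k : ℝ) + 1)) * ∫ x, f x ∂(ν : Measure X) +
        1 / ((k : ℝ) + 1) * ∫ x, f x ∂(π k : Measure X) := by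
    intro k
    change ∫ x, f x ∂(ENNReal.ofReal (1 - 1 / ((k : ℝ) + 1)) • (ν : Measure X) +
      ENNReal.ofReal (1 / ((k : ℝ) + 1)) • (π k : Measure X)) = _
    have hf : ∀ μ : ProbabilityMeasure X, Integrable f (μ : Measure X) :=
      fun μ => f.integrable _
    rw [integral_add_measure ((hf ν).smul_measure ENNReal.ofReal_ne_top)
      ((hf (π k)).smul_measure ENNReal.ofReal_ne_top), integral_smul_measure,
      integral_smul_measure, ENNReal.toReal_ofReal (by linarith [(hε k).2]),
      ENNReal.toReal_ofReal (hε k).1, smul_eq_mul, smul_eq_mul]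
  simp only [hint]
  have h0 : Tendsto (fun k : ℕ => 1 / ((k : ℝ) + 1)) atTop (𝓝 0) :=
    tendsto_one_div_add_atTop_nhds_zero_nat
  have h1 : Tendsto (fun k : ℕ => (1 - 1 / ((k : ℝ) + 1)) * ∫ x, f x ∂(ν : Measure X)) atTop
      (𝓝 ((1 - 0) * ∫ x, f x ∂(ν : Measure X))) := (tendsto_const_nhds.sub h0).mul_const _
  have h2 : Tendsto (fun k : ℕ => 1 / ((k : ℝ) + 1) * ∫ x, f x ∂(π k : Measure X)) atTop
      (𝓝 0) := by
    refine h0.zero_mul_isBoundedUnder_le ?_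
    refine isBoundedUnder_of ⟨‖f‖, fun k => ?_⟩
    have := norm_integral_le_of_norm_le_const (μ := (π k : Measure X))
      (Eventually.of_forall f.norm_coe_le_norm)
    simpa using this
  simpa using h1.add h2

end ProbabilityMeasure

/-! ### The residual set of charging measures. -/

namespace CellSystem

variable {X : Type*} [MetricSpace X] (𝒟 : CellSystem X)

/-- The pairs `(Q, i)` over which `chargingSet` quantifies. -/
def chargingIndex (t : ℝ) (n : ℕ) : Set ((ℕ × X) × ℕ) :=
  {j | 𝒟.Good t j.1 ∧ j.1.1 ≤ n ∧ 0 < j.2 ∧ (j.2 : ℝ) / (n + 1) ≤ t}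

variable {𝒟} in
theorem finite_chargingIndex (t : ℝ) (n : ℕ) : (𝒟.chargingIndex t n).Finite := by
  refine ((𝒟.finite_isCell_level_le n).prod (Set.finite_Iic ⌊t * (n + 1)⌋₊)).subset ?_
  rintro ⟨Q, i⟩ ⟨h1, h2, -, h4⟩
  refine ⟨⟨h1.1, h2⟩, Nat.le_floor ?_⟩
  rwa [div_le_iff₀ (by positivity)] at h4

variable [MeasurableSpace X] [BorelSpace X]

/-- The probability measures charging, for every good cell `Q` of level at most `n` and every
exponent `i / (n + 1) ≤ t`, all the cells of some spread family of level at least `L`. -/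
def chargingSet (t : ℝ) (n L : ℕ) : Set (ProbabilityMeasure X) :=
  {μ | ∀ Q, 𝒟.Good t Q → Q.1 ≤ n → ∀ i : ℕ, 0 < i → (i : ℝ) / (n + 1) ≤ t →
    ∃ S, 𝒟.IsSpread t ((i : ℝ) / (n + 1)) Q L S ∧ ∀ p ∈ S,
      ENNReal.ofReal (cellWeight ((i : ℝ) / (n + 1) + 1 / (n + 1)) p) <
        (μ : Measure X) (Metric.ball p.2 (2⁻¹ ^ p.1))}

variable {𝒟}

/-- Only finitely many pairs `(Q, i)` occur, and a strict lower bound on the mass of an open ball is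
a weakly open condition. -/
theorem isOpen_chargingSet (t : ℝ) (n L : ℕ) : IsOpen (𝒟.chargingSet t n L) := by
  have : 𝒟.chargingSet t n L = ⋂ j ∈ 𝒟.chargingIndex t n,
      ⋃ S ∈ {S | 𝒟.IsSpread t ((j.2 : ℝ) / (n + 1)) j.1 L S}, ⋂ p ∈ S,
        {μ : ProbabilityMeasure X |
          ENNReal.ofReal (cellWeight ((j.2 : ℝ) / (n + 1) + 1 / (n + 1)) p) <
            (μ : Measure X) (Metric.ball p.2 (2⁻¹ ^ p.1))} := by
    ext μ
    simp only [chargingSet, chargingIndex, Set.mem_ofPred_eq, Set.mem_iInter, Set.mem_iUnion,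
      Prod.forall, exists_prop, and_imp]
    exact ⟨fun h k x i h1 h2 h3 h4 => h k x h1 h2 i h3 h4,
      fun h k x h1 h2 i h3 h4 => h k x i h1 h2 h3 h4⟩
  rw [this]
  exact (finite_chargingIndex t n).isOpen_biInter fun j _ => isOpen_biUnion fun S _ =>
    isOpen_biInter_finset fun p _ => isOpen_setOf_lt_measure Metric.isOpen_ball _

open Classical in
-- Mixing in weights `2⁻ˡᵃ`, with `a = i / (n + 1)`, costs the fixed factor `ε / (2 * J.card + 1)`.
-- The surplus `1 / (n + 1)` in the required exponent absorbs it once the cells are deep enough.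
theorem dense_iUnion_chargingSet (t : ℝ) (n : ℕ) :
    Dense (⋃ L ∈ Set.Ici n, 𝒟.chargingSet t n L) := by
  refine dense_of_forall_mix_mem fun ν ε hε hε0 => ?_
  obtain ⟨x₀⟩ := ν.nonempty
  let J := (finite_chargingIndex (𝒟 := 𝒟) t n).toFinset
  have hn : (0 : ℝ) < n + 1 := by positivity
  obtain ⟨L, hnL, hL⟩ := exists_level_cellWeight_lt (X := X) (s := 1 / (n + 1))
    (δ := ε / (2 * J.card + 1)) (by positivity) (by positivity) n
  have hex : ∀ j : (ℕ × X) × ℕ, ∃ S, j ∈ J → 𝒟.IsSpread t ((j.2 : ℝ) / (n + 1)) j.1 L S := by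
    intro j
    by_cases hj : j ∈ J
    · have hj' := (Set.Finite.mem_toFinset _).1 hj
      have h0 : (0 : ℝ) < j.2 := by exact_mod_cast hj'.2.2.1
      obtain ⟨S, hS⟩ := exists_isSpread (α := (j.2 : ℝ) / (n + 1)) (by positivity) hj'.2.2.2
        hj'.1 L
      exact ⟨S, fun _ => hS⟩
    · exact ⟨∅, fun h => absurd h hj⟩
  choose S hS using hex
  obtain ⟨π, hπ⟩ := exists_probabilityMeasure_le J S
    (fun j p => cellWeight ((j.2 : ℝ) / (n + 1)) p) (fun j p => (cellWeight_pos _ _).le)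
    (fun j hj => by
      have hj' := (Set.Finite.mem_toFinset _).1 hj
      have h1 := (hS j hj).sum_le j.1 hj'.1.1 hj'.1.1.sub_refl
      rw [Finset.filter_true_of_mem (hS j hj).sub] at h1
      have h2 := cellWeight_le_one (s := (j.2 : ℝ) / (n + 1)) (by positivity) j.1
      linarith) x₀
  refine ⟨π, Set.mem_iUnion₂.2 ⟨L, hnL, fun Q hQ hQn i hi hit => ?_⟩⟩
  have hj : ((Q, i) : (ℕ × X) × ℕ) ∈ J := (Set.Finite.mem_toFinset _).2 ⟨hQ, hQn, hi, hit⟩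
  refine ⟨S (Q, i), hS _ hj, fun p hp => ?_⟩
  have h1 := hπ _ hj p hp (Metric.ball p.2 (2⁻¹ ^ p.1)) (Metric.mem_ball_self (by positivity))
  have h2 := hL p ((hS _ hj).level p hp)
  calc ENNReal.ofReal (cellWeight ((i : ℝ) / (n + 1) + 1 / (n + 1)) p)
      < ENNReal.ofReal (ε * (cellWeight ((i : ℝ) / (n + 1)) p / (2 * J.card + 1))) := by
        rw [ENNReal.ofReal_lt_ofReal_iff
          (mul_pos hε0 (div_pos (cellWeight_pos _ _) (by positivity))), cellWeight_add]
        calc _ < cellWeight ((i : ℝ) / (n + 1)) p * (ε / (2 * J.card + 1)) := by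
              gcongr
              exact cellWeight_pos _ _
          _ = _ := by ring
    _ ≤ ENNReal.ofReal ε * (π : Measure X) (Metric.ball p.2 (2⁻¹ ^ p.1)) := by
        rw [ENNReal.ofReal_mul hε0.le]
        gcongr
    _ ≤ _ := by
        change _ ≤ (ENNReal.ofReal (1 - ε) • (ν : Measure X) +
          ENNReal.ofReal ε • (π : Measure X)) _
        simp only [Measure.add_apply, Measure.smul_apply, smul_eq_mul]
        exact le_add_self

variable (𝒟) in
/-- The probability measures that lie, for every `n`, in `chargingSet t n L` for some `L ≥ n`. -/
def chargingResidual (t : ℝ) : Set (ProbabilityMeasure X) :=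
  ⋂ n : ℕ, ⋃ L ∈ Set.Ici n, 𝒟.chargingSet t n L

theorem isGδ_chargingResidual (t : ℝ) : IsGδ (𝒟.chargingResidual t) :=
  .iInter_of_isOpen fun n => isOpen_biUnion fun L _ => isOpen_chargingSet t n L

theorem dense_chargingResidual [CompactSpace X] (t : ℝ) : Dense (𝒟.chargingResidual t) :=
  dense_iInter_of_isOpen (fun n => isOpen_biUnion fun L _ => isOpen_chargingSet t n L)
    (dense_iUnion_chargingSet t)

end CellSystem

/-! ### Lower local dimension and masses of balls. -/

section LocalDim

theorem log_div_log_le_iff {m : ℝ≥0∞} {r : ℝ} (s : ℝ) (h0 : 0 < r) (h1 : r < 1) :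
    ENNReal.log m / ((Real.log r : ℝ) : EReal) ≤ (s : EReal) ↔ ENNReal.ofReal (r ^ s) ≤ m := by
  have hlog : Real.log r < 0 := Real.log_neg h0 h1
  have hs : ENNReal.log (ENNReal.ofReal (r ^ s)) / ((Real.log r : ℝ) : EReal) = (s : EReal) := by
    rw [ENNReal.log_ofReal_of_pos (by positivity), Real.log_rpow h0, ← EReal.coe_div,
      mul_div_cancel_right₀ _ hlog.ne]
  constructor
  · intro h
    by_contra! hm
    have := EReal.div_lt_div_right_of_neg (c := ((Real.log r : ℝ) : EReal))
      (by exact_mod_cast hlog) (EReal.coe_ne_bot _) (ENNReal.log_lt_log hm)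
    rw [hs] at this
    exact absurd h (not_le.2 this)
  · intro h
    rw [← hs]
    exact EReal.div_le_div_right_of_nonpos (by exact_mod_cast hlog.le) (ENNReal.log_le_log h)

variable {X : Type*} [PseudoMetricSpace X] [MeasurableSpace X] {μ : Measure X} {x : X}

theorem eventually_nhdsGT_zero_mem_Ioo : ∀ᶠ r : ℝ in 𝓝[>] 0, r ∈ Set.Ioo (0 : ℝ) 1 :=
  Ioo_mem_nhdsGT one_pos

theorem lowerLocalDim_le_of_frequently {s : ℝ}
    (h : ∃ᶠ r : ℝ in 𝓝[>] 0, ENNReal.ofReal (r ^ s) ≤ μ (Metric.ball x r)) :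
    lowerLocalDim μ x ≤ (s : EReal) :=
  liminf_le_of_frequently_le <| (h.and_eventually eventually_nhdsGT_zero_mem_Ioo).mono
    fun _ hr => (log_div_log_le_iff s hr.2.1 hr.2.2).2 hr.1

theorem frequently_of_lowerLocalDim_lt {s : ℝ} (h : lowerLocalDim μ x < (s : EReal)) :
    ∃ᶠ r : ℝ in 𝓝[>] 0, ENNReal.ofReal (r ^ s) ≤ μ (Metric.ball x r) :=
  ((frequently_lt_of_liminf_lt (by isBoundedDefault) h).and_eventually
    eventually_nhdsGT_zero_mem_Ioo).mono
    fun _ hr => (log_div_log_le_iff s hr.2.1 hr.2.2).1 hr.1.le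

end LocalDim

/-! ### The upper bound, valid for every finite measure. -/

section UpperBound

variable {X : Type*} [MetricSpace X] [MeasurableSpace X] [BorelSpace X]
  [TopologicalSpace.SeparableSpace X]

/-- Vitali's lemma extracts disjoint balls of radius below `2⁻ᵏ` whose fourfold enlargements cover
`A`. Their sum of `(8 r) ^ s` is at most `8 ^ s` times the sum of the masses, hence at most `8 ^ s *
μ univ`, uniformly in `k`. -/
theorem hausdorffMeasure_ne_top_of_frequently {μ : Measure X} [IsFiniteMeasure μ] {s : ℝ}
    (hs : 0 < s) {A : Set X}
    (hA : ∀ x ∈ A, ∃ᶠ r : ℝ in 𝓝[>] 0, ENNReal.ofReal (r ^ s) ≤ μ (Metric.ball x r)) :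
    μH[s] A ≠ ∞ := by
  have key : ∀ k : ℕ, ∃ r : X → ℝ, ∀ x ∈ A, 0 < r x ∧ r x < 2⁻¹ ^ k ∧
      ENNReal.ofReal (r x ^ s) ≤ μ (Metric.ball x (r x)) := by
    intro k
    have hk : ∀ᶠ r : ℝ in 𝓝[>] 0, r ∈ Set.Ioo (0 : ℝ) (2⁻¹ ^ k) :=
      Ioo_mem_nhdsGT (by positivity)
    have : ∀ x, ∃ r : ℝ, x ∈ A → 0 < r ∧ r < 2⁻¹ ^ k ∧
        ENNReal.ofReal (r ^ s) ≤ μ (Metric.ball x r) := by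
      intro x
      by_cases hx : x ∈ A
      · obtain ⟨r, hr, hr'⟩ := ((hA x hx).and_eventually hk).exists
        exact ⟨r, fun _ => ⟨hr'.1, hr'.2, hr⟩⟩
      · exact ⟨0, fun h => absurd h hx⟩
    choose r hr using this
    exact ⟨r, hr⟩
  choose r hr using key
  have hV := fun k => Vitali.exists_disjoint_subfamily_covering_enlargement_closedBall A id (r k)
    (2⁻¹ ^ k) (fun x hx => (hr k x hx).2.1.le) 4 (by norm_num)
  simp only [id] at hV
  choose u huA hdisj hcov using hV
  have hcount : ∀ k, (u k).Countable := fun k =>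
    (hdisj k).countable_of_nonempty_interior fun x hx =>
      ⟨x, Metric.ball_subset_interior_closedBall
        (Metric.mem_ball_self (hr k x (huA k hx)).1)⟩
  have : ∀ k, Countable (u k) := fun k => (hcount k).to_subtype
  have hdiam : ∀ k, ∀ x : u k, Metric.ediam (Metric.closedBall (x : X) (4 * r k x)) ≤
      ENNReal.ofReal (8 * r k x) := by
    intro k x
    refine Metric.ediam_le fun y hy z hz => ?_
    rw [edist_dist]
    refine ENNReal.ofReal_le_ofReal ?_
    rw [Metric.mem_closedBall] at hy hz
    linarith [dist_triangle_right y z x]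
  have hlim : Tendsto (fun k : ℕ => ENNReal.ofReal (8 * 2⁻¹ ^ k)) atTop (𝓝 0) := by
    have : Tendsto (fun k : ℕ => 8 * (2⁻¹ : ℝ) ^ k) atTop (𝓝 (8 * 0)) :=
      (tendsto_pow_atTop_nhds_zero_of_lt_one (by norm_num) (by norm_num)).const_mul _
    simpa using ENNReal.tendsto_ofReal this
  have hH := Measure.hausdorffMeasure_le_liminf_tsum s A _ hlim
    (fun k (x : u k) => Metric.closedBall (x : X) (4 * r k x))
    (Eventually.of_forall fun k x => (hdiam k x).trans <| ENNReal.ofReal_le_ofReal <| by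
      linarith [(hr k x (huA k x.2)).2.1])
    (Eventually.of_forall fun k x hx => by
      obtain ⟨y, hy, hxy⟩ := hcov k x hx
      exact Set.mem_iUnion.2 ⟨⟨y, hy⟩, hxy (Metric.mem_closedBall_self (hr k x hx).1.le)⟩)
  have hbound : ∀ k, ∑' x : u k, Metric.ediam (Metric.closedBall (x : X) (4 * r k x)) ^ s ≤
      ENNReal.ofReal (8 ^ s) * μ Set.univ := by
    intro k
    calc ∑' x : u k, Metric.ediam (Metric.closedBall (x : X) (4 * r k x)) ^ s
        ≤ ∑' x : u k, ENNReal.ofReal (8 ^ s) * μ (Metric.closedBall (x : X) (r k x)) := by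
          refine ENNReal.tsum_le_tsum fun x => ?_
          obtain ⟨h1, -, h3⟩ := hr k x (huA k x.2)
          calc _ ≤ ENNReal.ofReal (8 * r k x) ^ s := ENNReal.rpow_le_rpow (hdiam k x) hs.le
            _ = ENNReal.ofReal (8 ^ s) * ENNReal.ofReal (r k x ^ s) := by
                rw [ENNReal.ofReal_rpow_of_nonneg (by positivity) hs.le,
                  Real.mul_rpow (by norm_num) h1.le, ENNReal.ofReal_mul (by positivity)]
            _ ≤ _ := by
                gcongr
                exact h3.trans (measure_mono Metric.ball_subset_closedBall)
      _ = ENNReal.ofReal (8 ^ s) * μ (⋃ x ∈ u k, Metric.closedBall x (r k x)) := by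
          rw [ENNReal.tsum_mul_left, measure_biUnion (hcount k) (hdisj k)
            fun x _ => Metric.isClosed_closedBall.measurableSet]
      _ ≤ _ := by gcongr; exact Set.subset_univ _
  refine ne_top_of_le_ne_top (b := ENNReal.ofReal (8 ^ s) * μ Set.univ)
    (ENNReal.mul_ne_top ENNReal.ofReal_ne_top (measure_ne_top μ Set.univ)) (hH.trans ?_)
  exact (liminf_le_liminf (Eventually.of_forall hbound)).trans (liminf_const _).le

theorem dimH_setOf_lowerLocalDim_le (μ : Measure X) [IsFiniteMeasure μ] (β : ℝ≥0) :
    dimH {x | lowerLocalDim μ x ≤ ((β : ℝ) : EReal)} ≤ β := by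
  refine ENNReal.le_of_forall_pos_le_add fun ε hε _ => ?_
  rw [← ENNReal.coe_add]
  refine dimH_le_of_hausdorffMeasure_ne_top
    (hausdorffMeasure_ne_top_of_frequently (μ := μ) (by positivity) fun x hx => ?_)
  refine frequently_of_lowerLocalDim_lt (lt_of_le_of_lt hx ?_)
  exact_mod_cast lt_add_of_pos_right β hε

end UpperBound

/-! ### The tree of weighted antichains. -/

namespace CellSystem

variable {X : Type*} [MetricSpace X] (𝒟 : CellSystem X)

/-- A probability vector `w` on a finite antichain `T` of good cells, with `w p` at most the
`b`-th power of the scale of `p`. -/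
structure IsWeighted (t b : ℝ) (T : Finset (ℕ × X)) (w : ℕ × X → ℝ) : Prop where
  good : ∀ p ∈ T, 𝒟.Good t p
  antichain : ∀ p ∈ T, ∀ q ∈ T, 𝒟.Sub p q → q = p
  nonneg : ∀ p ∈ T, 0 ≤ w p
  sum_eq_one : ∑ p ∈ T, w p = 1
  le_cellWeight : ∀ p ∈ T, w p ≤ cellWeight b p

open Classical in
/-- The weighted antichain `(T', w')` refines `(T, w)`, distributing the mass of each cell of `T`
evenly with respect to the exponent `b`, and its cells have `μ`-mass at least `2⁻ˡᵃ`. -/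
structure IsRefinement [MeasurableSpace X] (μ : Measure X) (a b : ℝ) (m : ℕ)
    (T : Finset (ℕ × X)) (w : ℕ × X → ℝ) (T' : Finset (ℕ × X)) (w' : ℕ × X → ℝ) : Prop where
  exists_parent : ∀ p ∈ T', ∃ q ∈ T, 𝒟.Sub p q
  sum_eq : ∀ q ∈ T, ∑ p ∈ T' with 𝒟.Sub p q, w' p = w q
  sum_le : ∀ q ∈ T, ∀ R, 𝒟.IsCell R → 𝒟.Sub R q →
    ∑ p ∈ T' with 𝒟.Sub p R, w' p ≤ 16 * cellWeight b R
  level : ∀ p ∈ T', m ≤ p.1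
  charge : ∀ p ∈ T', ENNReal.ofReal (cellWeight a p) ≤ μ (Metric.ball p.2 (2⁻¹ ^ p.1))

variable {𝒟}

open Classical in
/-- Splitting the mass of every cell of a weighted antichain along a spread family. -/
theorem IsWeighted.exists_split {t a b b' κ : ℝ} {T : Finset (ℕ × X)} {w : ℕ × X → ℝ}
    (h : 𝒟.IsWeighted t b T w) {L : ℕ} {S : ℕ × X → Finset (ℕ × X)}
    (hS : ∀ Q ∈ T, 𝒟.IsSpread t a Q L (S Q)) (hb : 0 ≤ b) (hba : b ≤ a) (hκ0 : 0 < κ)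
    (hκ : ∀ Q ∈ T, κ ≤ cellWeight a Q)
    (hL : ∀ p : ℕ × X, L ≤ p.1 → 8 * cellWeight (a - b') p ≤ κ) :
    ∃ w' : ℕ × X → ℝ, 𝒟.IsWeighted t b' (T.biUnion S) w' ∧
      (∀ q ∈ T, ∑ p ∈ T.biUnion S with 𝒟.Sub p q, w' p = w q) ∧
      ∀ q ∈ T, ∀ R, 𝒟.IsCell R → 𝒟.Sub R q →
        ∑ p ∈ T.biUnion S with 𝒟.Sub p R, w' p ≤ 16 * cellWeight b R := by
  have huniq : ∀ p, ∀ Q ∈ T, ∀ Q' ∈ T, 𝒟.Sub p Q → 𝒟.Sub p Q' → Q' = Q := by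
    intro p Q hQ Q' hQ' h1 h2
    rcases le_total Q.1 Q'.1 with hl | hl
    · exact (h.antichain _ hQ' _ hQ (h2.sub_of_level_le h1 hl)).symm
    · exact h.antichain _ hQ _ hQ' (h1.sub_of_level_le h2 hl)
  let W : ℕ × X → ℝ := fun Q => ∑ p ∈ S Q, cellWeight a p
  have hW : ∀ Q ∈ T, cellWeight a Q ≤ 8 * W Q := fun Q hQ => (hS Q hQ).le_sum
  have hWpos : ∀ Q ∈ T, 0 < W Q := fun Q hQ => by
    have := hW Q hQ
    have := cellWeight_pos a Q
    linarith
  -- For `p` inside a cell of the antichain `T` the sum has exactly one term, the share of `p` in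
  -- the mass of its parent.
  let w' : ℕ × X → ℝ := fun p => ∑ Q ∈ T with 𝒟.Sub p Q, w Q * cellWeight a p / W Q
  have hw' : ∀ p, ∀ Q ∈ T, 𝒟.Sub p Q → w' p = w Q * cellWeight a p / W Q := by
    intro p Q hQ hpQ
    have : T.filter (𝒟.Sub p ·) = {Q} := by
      ext Q'
      simp only [Finset.mem_filter, Finset.mem_singleton]
      exact ⟨fun h' => huniq p Q hQ Q' h'.1 hpQ h'.2, fun h' => h' ▸ ⟨hQ, hpQ⟩⟩
    simp only [w', this, Finset.sum_singleton]
  have hparent : ∀ p ∈ T.biUnion S, ∃ Q ∈ T, p ∈ S Q ∧ 𝒟.Sub p Q := by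
    intro p hp
    obtain ⟨Q, hQ, hpQ⟩ := Finset.mem_biUnion.1 hp
    exact ⟨Q, hQ, hpQ, (hS Q hQ).sub p hpQ⟩
  have hfilter : ∀ Q ∈ T, ∀ R, 𝒟.IsCell R → 𝒟.Sub R Q →
      (T.biUnion S).filter (𝒟.Sub · R) = (S Q).filter (𝒟.Sub · R) := by
    intro Q hQ R hR hRQ
    ext p
    simp only [Finset.mem_filter]
    refine ⟨fun ⟨hp, hpR⟩ => ⟨?_, hpR⟩, fun ⟨hp, hpR⟩ => ⟨Finset.mem_biUnion.2 ⟨Q, hQ, hp⟩, hpR⟩⟩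
    obtain ⟨Q', hQ', hp', hpQ'⟩ := hparent p hp
    rwa [huniq p Q hQ Q' hQ' (hpR.trans hR hRQ) hpQ'] at hp'
  have hsum : ∀ Q ∈ T, ∀ R, 𝒟.IsCell R → 𝒟.Sub R Q →
      ∑ p ∈ T.biUnion S with 𝒟.Sub p R, w' p =
        w Q / W Q * ∑ p ∈ S Q with 𝒟.Sub p R, cellWeight a p := by
    intro Q hQ R hR hRQ
    rw [hfilter Q hQ R hR hRQ, Finset.mul_sum]
    refine Finset.sum_congr rfl fun p hp => ?_
    rw [hw' p Q hQ ((Finset.mem_filter.1 hp).2.trans hR hRQ)]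
    ring
  have hsumQ : ∀ q ∈ T, ∑ p ∈ T.biUnion S with 𝒟.Sub p q, w' p = w q := by
    intro Q hQ
    have hcell := (h.good Q hQ).1
    rw [hsum Q hQ Q hcell hcell.sub_refl, Finset.filter_true_of_mem (hS Q hQ).sub]
    exact div_mul_cancel₀ _ (hWpos Q hQ).ne'
  have hwW : ∀ Q ∈ T, w Q / W Q ≤ 8 * (cellWeight b Q / cellWeight a Q) := by
    intro Q hQ
    have h1 := cellWeight_pos a Q
    have h2 := cellWeight_pos b Q
    rw [div_le_iff₀ (hWpos Q hQ)]
    calc w Q ≤ cellWeight b Q := h.le_cellWeight Q hQ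
      _ = (cellWeight b Q / cellWeight a Q) * cellWeight a Q := by field_simp
      _ ≤ (cellWeight b Q / cellWeight a Q) * (8 * W Q) := by gcongr; exact hW Q hQ
      _ = _ := by ring
  refine ⟨w', ⟨?_, ?_, ?_, ?_, ?_⟩, hsumQ, ?_⟩
  · intro p hp
    obtain ⟨Q, hQ, hpQ, -⟩ := hparent p hp
    exact (hS Q hQ).good p hpQ
  · intro p hp q hq hpq
    obtain ⟨Q, hQ, hpQ, hpQ'⟩ := hparent p hp
    obtain ⟨Q', hQ', hqQ, hqQ'⟩ := hparent q hq
    obtain rfl : Q' = Q :=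
      huniq p Q hQ Q' hQ' hpQ' (hpq.trans ((hS Q' hQ').good q hqQ).1 hqQ')
    exact (hS Q' hQ).antichain p hpQ q hqQ hpq
  · intro p hp
    obtain ⟨Q, hQ, -, hpQ⟩ := hparent p hp
    rw [hw' p Q hQ hpQ]
    exact div_nonneg (mul_nonneg (h.nonneg Q hQ) (cellWeight_pos _ _).le) (hWpos Q hQ).le
  · have hT : T.biUnion S = T.biUnion fun q => (T.biUnion S).filter (𝒟.Sub · q) := by
      ext p
      simp only [Finset.mem_biUnion (s := T) (t := fun q => (T.biUnion S).filter (𝒟.Sub · q)),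
        Finset.mem_filter]
      refine ⟨fun hp => ?_, fun ⟨_, _, hp, _⟩ => hp⟩
      obtain ⟨Q, hQ, -, hpQ⟩ := hparent p hp
      exact ⟨Q, hQ, hp, hpQ⟩
    rw [hT, Finset.sum_biUnion (pairwiseDisjoint_filter_sub (𝓐 := (T : Set (ℕ × X)))
      h.antichain _), Finset.sum_congr rfl hsumQ, h.sum_eq_one]
  · intro p hp
    obtain ⟨Q, hQ, hpQ, hpQ'⟩ := hparent p hp
    have h1 := hL p ((hS Q hQ).level p hpQ)
    -- The loss at `Q` is at most `8 / κ`; the factor `2^(-(a - b')ℓ)` at levels `ℓ ≥ L` compensates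
    -- it.
    have h2 : 8 * (cellWeight b Q / cellWeight a Q) ≤ 8 / κ := by
      rw [← mul_div_assoc]
      gcongr
      · linarith [cellWeight_le_one hb Q]
      · exact hκ Q hQ
    have h3 : cellWeight a p = cellWeight (a - b') p * cellWeight b' p := by
      rw [← cellWeight_add, sub_add_cancel]
    rw [hw' p Q hQ hpQ', mul_div_right_comm]
    have h4 := cellWeight_pos b' p
    calc w Q / W Q * cellWeight a p ≤ 8 / κ * cellWeight a p :=
          mul_le_mul_of_nonneg_right ((hwW Q hQ).trans h2) (cellWeight_pos _ _).le
      _ = (8 * cellWeight (a - b') p) / κ * cellWeight b' p := by rw [h3]; ring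
      _ ≤ κ / κ * cellWeight b' p := by gcongr
      _ = cellWeight b' p := by rw [div_self hκ0.ne', one_mul]
  · intro Q hQ R hR hRQ
    have h1 := cellWeight_pos a Q
    have h2 := cellWeight_pos b Q
    have h3 : cellWeight (a - b) R ≤ cellWeight (a - b) Q :=
      cellWeight_le_of_level_le (by linarith) hRQ.1
    rw [cellWeight_sub, cellWeight_sub, div_le_div_iff₀ (cellWeight_pos _ _) h2] at h3
    rw [hsum Q hQ R hR hRQ]
    -- The 8 comes from the total weight of the spread family, the 2 from its bound on subcells.
    -- Since `b ≤ a` and `R` lies in `Q`, the exponent `a` may be lowered to `b`.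
    calc w Q / W Q * ∑ p ∈ S Q with 𝒟.Sub p R, cellWeight a p
        ≤ (8 * (cellWeight b Q / cellWeight a Q)) * (2 * cellWeight a R) :=
          mul_le_mul (hwW Q hQ) ((hS Q hQ).sum_le R hR hRQ)
            (Finset.sum_nonneg fun p _ => (cellWeight_pos _ _).le) (by positivity)
      _ = 16 * ((cellWeight a R * cellWeight b Q) / cellWeight a Q) := by ring
      _ ≤ 16 * cellWeight b R := by
          gcongr
          rw [div_le_iff₀ h1]
          linarith

variable [MeasurableSpace X] {μ : ProbabilityMeasure X}

open Classical in
-- Membership in the residual set gives, for each `n`, spread families charged by `μ` inside the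
-- good cells of level at most `n`. For `n` large, all cells of `T` qualify and some exponent `i /
-- (n + 1)` is close enough to `α`.
theorem IsWeighted.exists_refinement {t α b b' : ℝ} (hμ : μ ∈ 𝒟.chargingResidual t) (hα : 0 < α)
    (hαt : α ≤ t) (hb : 0 ≤ b) (hbα : b < α) (hb'α : b' < α) {T : Finset (ℕ × X)}
    {w : ℕ × X → ℝ} (h : 𝒟.IsWeighted t b T w) (m : ℕ) :
    ∃ T' w', 𝒟.IsWeighted t b' T' w' ∧
      𝒟.IsRefinement (μ : Measure X) (α + 1 / (m + 1)) b m T w T' w' := by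
  set Λ := T.sup Prod.fst
  have hΛ : ∀ Q ∈ T, Q.1 ≤ Λ := fun Q hQ => Finset.le_sup (f := Prod.fst) hQ
  -- This lower bound uses `α` instead of the exponent `a`, which depends on `n`. It must be fixed
  -- before `n`: only `L ≥ n` is known about `L`, so `n` itself has to beat `κ`.
  set κ : ℝ := (2 : ℝ) ^ (-(α * Λ)) with hκ
  have hκ0 : 0 < κ := by positivity
  obtain ⟨n₀, -, hn₀⟩ := exists_level_cellWeight_lt (X := X) (s := (α - b') / 2) (δ := κ / 8)
    (by linarith) (by positivity) 0
  obtain ⟨n₁, hn₁⟩ := exists_nat_one_div_lt (K := ℝ) (ε := min (α - b) ((α - b') / 2))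
    (lt_min (by linarith) (by linarith))
  set n := max (max m Λ) (max n₀ n₁)
  have hnpos : (0 : ℝ) < n + 1 := by positivity
  have hn : (1 : ℝ) / (n + 1) < min (α - b) ((α - b') / 2) := by
    refine lt_of_le_of_lt ?_ hn₁
    have : (n₁ : ℝ) ≤ n := by exact_mod_cast (le_max_right _ _).trans (le_max_right _ _)
    gcongr
  have hnm : (1 : ℝ) / (n + 1) ≤ 1 / (m + 1) := by
    have : (m : ℝ) ≤ n := by exact_mod_cast (le_max_left _ _).trans (le_max_left _ _)
    gcongr
  -- The grid exponent just below `α`: then `b < a ≤ α < a + 1 / (n + 1)`.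
  set i := ⌊α * (n + 1)⌋₊
  set a : ℝ := (i : ℝ) / (n + 1)
  have haα : a ≤ α := by
    rw [div_le_iff₀ hnpos]
    exact Nat.floor_le (by positivity)
  have hαa : α < a + 1 / (n + 1) := by
    rw [← add_div, lt_div_iff₀ hnpos]
    exact Nat.lt_floor_add_one _
  have hba : b < a := by linarith [hn.trans_le (min_le_left _ _)]
  have hb'a : (α - b') / 2 ≤ a - b' := by linarith [hn.trans_le (min_le_right _ _)]
  have hi : 0 < i := by
    rcases Nat.eq_zero_or_pos i with h0 | h0
    · simp only [a, h0, Nat.cast_zero, zero_div] at hba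
      exact absurd hba (not_lt.2 hb)
    · exact h0
  obtain ⟨L, hL, hμL⟩ := Set.mem_iUnion₂.1 (Set.mem_iInter.1 hμ n)
  have hex : ∀ Q, ∃ S, Q ∈ T → 𝒟.IsSpread t a Q L S ∧ ∀ p ∈ S,
      ENNReal.ofReal (cellWeight (a + 1 / (n + 1)) p) <
        (μ : Measure X) (Metric.ball p.2 (2⁻¹ ^ p.1)) := by
    intro Q
    by_cases hQ : Q ∈ T
    · obtain ⟨S, hS⟩ := hμL Q (h.good Q hQ)
        ((hΛ Q hQ).trans ((le_max_right _ _).trans (le_max_left _ _))) i hi (haα.trans hαt)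
      exact ⟨S, fun _ => hS⟩
    · exact ⟨∅, fun h => absurd h hQ⟩
  choose S hS using hex
  obtain ⟨w', hw', hsum, hle⟩ := h.exists_split (b' := b') (κ := κ) (fun Q hQ => (hS Q hQ).1)
    hb hba.le hκ0
    (fun Q hQ => by
      refine (cellWeight_le_of_level_le (p := (Λ, Q.2)) hα.le (hΛ Q hQ)).trans ?_
      exact cellWeight_anti haα Q)
    (fun p hp => by
      have h1 := cellWeight_anti hb'a p
      have h2 := hn₀ p (((le_max_left _ _).trans (le_max_right _ _)).trans (hL.trans hp))
      linarith)
  refine ⟨_, w', hw', ⟨fun p hp => ?_, hsum, hle, fun p hp => ?_, fun p hp => ?_⟩⟩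
  all_goals obtain ⟨Q, hQ, hpQ⟩ := Finset.mem_biUnion.1 hp
  · exact ⟨Q, hQ, (hS Q hQ).1.sub p hpQ⟩
  · exact ((le_max_left _ _).trans (le_max_left _ _)).trans
      (hL.trans ((hS Q hQ).1.level p hpQ))
  · refine le_trans (ENNReal.ofReal_le_ofReal (cellWeight_anti ?_ p)) ((hS Q hQ).2 p hpQ).le
    linarith

theorem exists_tree {t α : ℝ} (hμ : μ ∈ 𝒟.chargingResidual t) (hα : 0 < α) (hαt : α ≤ t)
    {b : ℕ → ℝ} (hb0 : b 0 = 0) (hbmono : Monotone b) (hbα : ∀ j, b j < α)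
    {Q : ℕ × X} (hQ : 𝒟.Good t Q) :
    ∃ (T : ℕ → Finset (ℕ × X)) (w : ℕ → ℕ × X → ℝ), (∀ j, 𝒟.IsWeighted t (b j) (T j) (w j)) ∧
      ∀ j : ℕ, 𝒟.IsRefinement (μ : Measure X) (α + 1 / (j + 1)) (b j) j (T j) (w j)
        (T (j + 1)) (w (j + 1)) := by
  -- A unit mass on `Q` is admissible because `b 0 = 0`.
  have hinit : 𝒟.IsWeighted t (b 0) {Q} fun _ => 1 :=
    ⟨by simpa using hQ, by simp, by simp, by simp, by simp [hb0]⟩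
  have hstep : ∀ (j : ℕ) (s : {s : Finset (ℕ × X) × (ℕ × X → ℝ) //
      𝒟.IsWeighted t (b j) s.1 s.2}), ∃ s' : {s : Finset (ℕ × X) × (ℕ × X → ℝ) //
      𝒟.IsWeighted t (b (j + 1)) s.1 s.2}, 𝒟.IsRefinement (μ : Measure X) (α + 1 / (j + 1)) (b j) j
        s.1.1 s.1.2 s'.1.1 s'.1.2 := by
    intro j s
    obtain ⟨T', w', h1, h2⟩ := s.2.exists_refinement hμ hα hαt (hb0 ▸ hbmono (Nat.zero_le j))
      (hbα j) (hbα (j + 1)) j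
    exact ⟨⟨(T', w'), h1⟩, h2⟩
  choose next hnext using hstep
  let s : ∀ j, {s : Finset (ℕ × X) × (ℕ × X → ℝ) // 𝒟.IsWeighted t (b j) s.1 s.2} :=
    fun j => Nat.rec ⟨({Q}, fun _ => 1), hinit⟩ next j
  exact ⟨fun j => (s j).1.1, fun j => (s j).1.2, fun j => (s j).2, fun j => hnext j (s j)⟩

end CellSystem

/-! ### The mass distribution principle. -/

/-- The mass distribution principle, along dyadic scales. -/
theorem measure_eq_zero_of_hausdorffMeasure_eq_zero {X : Type*} [MetricSpace X]
    [MeasurableSpace X] [BorelSpace X] {ν : Measure X} {b c : ℝ} (hb : 0 < b) (hc : 0 < c) (ℓ₀ : ℕ)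
    (h : ∀ ℓ, ℓ₀ ≤ ℓ → ∀ A : Set X, (∀ x ∈ A, ∀ y ∈ A, dist x y ≤ 2⁻¹ ^ ℓ) →
      ν A ≤ ENNReal.ofReal (c * (2⁻¹ ^ ℓ) ^ b)) {A : Set X} (hA : μH[b] A = 0) : ν A = 0 := by
  have hdist : ∀ {s : Set X} {δ : ℝ}, 0 ≤ δ → Metric.ediam s ≤ ENNReal.ofReal δ →
      ∀ x ∈ s, ∀ y ∈ s, dist x y ≤ δ := fun hδ hs x hx y hy => by
    have := (Metric.edist_le_ediam_of_mem hx hy).trans hs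
    rwa [edist_dist, ENNReal.ofReal_le_ofReal_iff hδ] at this
  set k : ℝ := c * 2 ^ b
  have hk : 0 < k := by positivity
  have key : ∀ s : Set X, Metric.ediam s ≤ ENNReal.ofReal (2⁻¹ ^ ℓ₀) →
      ν s ≤ ENNReal.ofReal k * Metric.ediam s ^ b := by
    intro s hs
    have htop : Metric.ediam s ≠ ∞ := ne_top_of_le_ne_top ENNReal.ofReal_ne_top hs
    -- A set of diameter zero satisfies the hypothesis at every scale, so it has mass zero.
    rcases eq_or_ne (Metric.ediam s) 0 with h0 | h0
    · have hlim : Tendsto (fun ℓ : ℕ => ENNReal.ofReal (c * (2⁻¹ ^ ℓ) ^ b)) atTop (𝓝 0) := by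
        have h1 : Tendsto (fun ℓ : ℕ => ((2⁻¹ : ℝ) ^ ℓ)) atTop (𝓝 0) :=
          tendsto_pow_atTop_nhds_zero_of_lt_one (by norm_num) (by norm_num)
        have h2 := (h1.rpow_const (Or.inr hb.le)).const_mul c
        rw [Real.zero_rpow hb.ne', mul_zero] at h2
        simpa using ENNReal.tendsto_ofReal h2
      refine (ge_of_tendsto hlim ?_).trans bot_le
      filter_upwards [eventually_ge_atTop ℓ₀] with ℓ hℓ
      exact h ℓ hℓ s (hdist (by positivity) (by simp [h0]))
    · set δ := (Metric.ediam s).toReal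
      have hδ : 0 < δ := ENNReal.toReal_pos h0 htop
      have hδe : Metric.ediam s = ENNReal.ofReal δ := (ENNReal.ofReal_toReal htop).symm
      rw [hδe] at hs ⊢
      rw [ENNReal.ofReal_le_ofReal_iff (by positivity)] at hs
      -- Rounding the diameter up to a dyadic scale at most doubles it, whence the factor `2 ^ b` in
      -- `k`.
      obtain ⟨n, hn1, hn2⟩ := exists_nat_pow_near_of_lt_one hδ
        (hs.trans (pow_le_one₀ (by norm_num) (by norm_num))) (by norm_num : (0 : ℝ) < 2⁻¹)
        (by norm_num)
      have hn : ℓ₀ ≤ n := by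
        have := hn1.trans_le hs
        rw [pow_lt_pow_iff_right_of_lt_one₀ (by norm_num) (by norm_num)] at this
        omega
      refine (h n hn s (hdist (by positivity)
        (hδe.le.trans (ENNReal.ofReal_le_ofReal hn2)))).trans ?_
      rw [ENNReal.ofReal_rpow_of_nonneg hδ.le hb.le, ← ENNReal.ofReal_mul hk.le]
      refine ENNReal.ofReal_le_ofReal ?_
      rw [mul_assoc, ← Real.mul_rpow two_pos.le hδ.le]
      gcongr
      rw [pow_succ] at hn1
      linarith
  have hle : (ENNReal.ofReal k)⁻¹ • ν ≤ μH[b] := by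
    refine Measure.le_hausdorffMeasure b _ (ENNReal.ofReal (2⁻¹ ^ ℓ₀))
      (ENNReal.ofReal_pos.2 (by positivity)) fun s hs => ?_
    rw [Measure.smul_apply, smul_eq_mul,
      ENNReal.inv_mul_le_iff (ENNReal.ofReal_pos.2 hk).ne' ENNReal.ofReal_ne_top]
    exact key s hs
  have h1 : ((ENNReal.ofReal k)⁻¹ • ν) A ≤ 0 := (hle A).trans hA.le
  rw [Measure.smul_apply, smul_eq_mul, nonpos_iff_eq_zero, mul_eq_zero] at h1
  exact h1.resolve_left (ENNReal.inv_ne_zero.2 ENNReal.ofReal_ne_top)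

/-! ### The limit measure on the tree. -/

namespace CellSystem

variable {X : Type*} [MetricSpace X] {𝒟 : CellSystem X} [MeasurableSpace X] {μ : Measure X}
  {t α : ℝ} {b : ℕ → ℝ} {T : ℕ → Finset (ℕ × X)} {w : ℕ → ℕ × X → ℝ}

theorem level_ge_of_isRefinement
    (href : ∀ j : ℕ, 𝒟.IsRefinement μ (α + 1 / (j + 1)) (b j) j (T j) (w j) (T (j + 1)) (w (j + 1)))
    {i ℓ : ℕ} (hi : ℓ + 1 ≤ i) {p : ℕ × X} (hp : p ∈ T i) : ℓ ≤ p.1 := by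
  obtain ⟨k, rfl⟩ := Nat.exists_eq_add_of_le' hi
  exact le_trans (by omega) ((href (k + ℓ)).level p hp)

theorem exists_ancestor (hw : ∀ j, 𝒟.IsWeighted t (b j) (T j) (w j))
    (href : ∀ j : ℕ, 𝒟.IsRefinement μ (α + 1 / (j + 1)) (b j) j (T j) (w j) (T (j + 1)) (w (j + 1)))
    {i j : ℕ} (hij : j ≤ i) {p : ℕ × X} (hp : p ∈ T i) : ∃ q ∈ T j, 𝒟.Sub p q := by
  induction i, hij using Nat.le_induction generalizing p with
  | base => exact ⟨p, hp, ((hw j).good p hp).1.sub_refl⟩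
  | succ i _ ih =>
    obtain ⟨r, hr, hpr⟩ := (href i).exists_parent p hp
    obtain ⟨q, hq, hrq⟩ := ih hr
    exact ⟨q, hq, hpr.trans ((hw i).good r hr).1 hrq⟩

open Classical in
-- If `R` lies inside a cell of the antichain `T i`, the refinement bound applies, and `b j ≤ b i`.
-- Otherwise the parents of the cells of `T (i + 1)` in `R` lie in `R` too, so mass conservation
-- reduces the claim to stage `i`. At stage `j`, no cell of `T j` other than `R` can lie in `R`.
theorem sum_weight_le (hbmono : Monotone b) (hw : ∀ j, 𝒟.IsWeighted t (b j) (T j) (w j))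
    (href : ∀ j : ℕ, 𝒟.IsRefinement μ (α + 1 / (j + 1)) (b j) j (T j) (w j) (T (j + 1)) (w (j + 1)))
    {i j : ℕ} (hij : j ≤ i) {R : ℕ × X} (hR : 𝒟.IsCell R) (hlev : ∀ p ∈ T j, p.1 ≤ R.1) :
    ∑ p ∈ T i with 𝒟.Sub p R, w i p ≤ 16 * cellWeight (b j) R := by
  induction i, hij using Nat.le_induction with
  | base =>
    have hsub : (T j).filter (𝒟.Sub · R) ⊆ {R} := by
      intro p hp
      obtain ⟨hp, hpR⟩ := Finset.mem_filter.1 hp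
      exact Finset.mem_singleton.2 (((hw j).good p hp).1.sub_refl.eq_of_level_eq hpR
        (le_antisymm (hlev p hp) hpR.1))
    rcases Finset.subset_singleton_iff.1 hsub with h | h
    · rw [h]
      simpa using (cellWeight_pos (b j) R).le
    · have hRT : R ∈ T j := (Finset.mem_filter.1 (h ▸ Finset.mem_singleton_self R)).1
      rw [h, Finset.sum_singleton]
      linarith [(hw j).le_cellWeight R hRT, cellWeight_pos (b j) R]
  | succ i hji ih =>
    by_cases hex : ∃ Q ∈ T i, 𝒟.Sub R Q
    · obtain ⟨Q, hQ, hRQ⟩ := hex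
      refine ((href i).sum_le Q hQ R hR hRQ).trans ?_
      have := cellWeight_anti (hbmono hji) R
      linarith
    refine le_trans ?_ ih
    have hanti : ∀ p ∈ ((T i).filter (𝒟.Sub · R) : Set (ℕ × X)),
        ∀ q ∈ ((T i).filter (𝒟.Sub · R) : Set (ℕ × X)), 𝒟.Sub p q → q = p := by
      intro p hp q hq
      exact (hw i).antichain p (Finset.mem_filter.1 (Finset.mem_coe.1 hp)).1 q
        (Finset.mem_filter.1 (Finset.mem_coe.1 hq)).1
    calc ∑ p ∈ T (i + 1) with 𝒟.Sub p R, w (i + 1) p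
        ≤ ∑ p ∈ ((T i).filter (𝒟.Sub · R)).biUnion fun Q => (T (i + 1)).filter (𝒟.Sub · Q),
            w (i + 1) p := by
          refine Finset.sum_le_sum_of_subset_of_nonneg (fun p hp => ?_) fun p hp _ => ?_
          · obtain ⟨hp, hpR⟩ := Finset.mem_filter.1 hp
            obtain ⟨Q, hQ, hpQ⟩ := (href i).exists_parent p hp
            refine Finset.mem_biUnion.2 ⟨Q, Finset.mem_filter.2 ⟨hQ, ?_⟩,
              Finset.mem_filter.2 ⟨hp, hpQ⟩⟩
            rcases le_total Q.1 R.1 with hl | hl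
            · exact absurd ⟨Q, hQ, hpR.sub_of_level_le hpQ hl⟩ hex
            · exact hpQ.sub_of_level_le hpR hl
          · obtain ⟨Q, -, hp⟩ := Finset.mem_biUnion.1 hp
            exact (hw (i + 1)).nonneg p (Finset.mem_filter.1 hp).1
      _ = ∑ Q ∈ T i with 𝒟.Sub Q R, w i Q := by
          rw [Finset.sum_biUnion (pairwiseDisjoint_filter_sub hanti _)]
          exact Finset.sum_congr rfl fun Q hQ => (href i).sum_eq Q (Finset.mem_filter.1 hQ).1

/-- The probability measure with mass `w p` at the distinguished point of each cell `p ∈ T`. -/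
noncomputable def IsWeighted.toProbabilityMeasure {b : ℝ} {T : Finset (ℕ × X)} {w : ℕ × X → ℝ}
    (h : 𝒟.IsWeighted t b T w) : ProbabilityMeasure X :=
  ⟨∑ p ∈ T, ENNReal.ofReal (w p) • Measure.dirac p.2, ⟨by
    simp [← ENNReal.ofReal_sum_of_nonneg h.nonneg, h.sum_eq_one]⟩⟩

open Classical in
theorem IsWeighted.toProbabilityMeasure_apply {b : ℝ} {T : Finset (ℕ × X)} {w : ℕ × X → ℝ}
    (h : 𝒟.IsWeighted t b T w) {A : Set X} (hA : MeasurableSet A) :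
    (h.toProbabilityMeasure : Measure X) A = ENNReal.ofReal (∑ p ∈ T with p.2 ∈ A, w p) := by
  change (∑ p ∈ T, ENNReal.ofReal (w p) • Measure.dirac p.2 : Measure X) A = _
  rw [ENNReal.ofReal_sum_of_nonneg fun p hp => h.nonneg p (Finset.mem_filter.1 hp).1,
    Finset.sum_filter]
  simp [Measure.finsetSum_apply, Measure.dirac_apply' _ hA, Set.indicator_apply]

variable [BorelSpace X]

open Classical in
-- At most `M` cells of level `ℓ` meet `G`, and `sum_weight_le` applies to each. The condition `ℓ +
-- 1 ≤ i` makes the cells of `T i` at least as deep as level `ℓ`.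
theorem toProbabilityMeasure_le (hbmono : Monotone b)
    (hw : ∀ j, 𝒟.IsWeighted t (b j) (T j) (w j))
    (href : ∀ j : ℕ, 𝒟.IsRefinement μ (α + 1 / (j + 1)) (b j) j (T j) (w j) (T (j + 1)) (w (j + 1)))
    {i j ℓ : ℕ} (hij : j ≤ i) (hℓi : ℓ + 1 ≤ i) (hlev : ∀ p ∈ T j, p.1 ≤ ℓ) {G : Set X}
    (hG : IsOpen G) (hGdist : ∀ x ∈ G, ∀ y ∈ G, dist x y ≤ 4 * 2⁻¹ ^ ℓ) :
    ((hw i).toProbabilityMeasure : Measure X) G ≤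
      ENNReal.ofReal (16 * 𝒟.M * (2⁻¹ ^ ℓ) ^ b j) := by
  rw [(hw i).toProbabilityMeasure_apply hG.measurableSet]
  refine ENNReal.ofReal_le_ofReal ?_
  have hcard := 𝒟.encard_image_le ℓ G hGdist
  have hfin : (𝒟.rep ℓ '' G).Finite := Set.finite_of_encard_le_coe hcard
  rw [hfin.encard_eq_coe_toFinset_card, Nat.cast_le] at hcard
  have hc : (hfin.toFinset.card : ℝ) ≤ 𝒟.M := by exact_mod_cast hcard
  have hdisj : (hfin.toFinset : Set X).PairwiseDisjoint
      fun y => (T i).filter (𝒟.Sub · ((ℓ, y) : ℕ × X)) := by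
    intro y _ y' _ hne
    refine Finset.disjoint_left.2 fun p hp hp' => hne ?_
    exact congrArg Prod.snd
      ((Finset.mem_filter.1 hp).2.eq_of_level_eq (Finset.mem_filter.1 hp').2 rfl)
  calc ∑ p ∈ T i with p.2 ∈ G, w i p
      ≤ ∑ p ∈ hfin.toFinset.biUnion fun y => (T i).filter (𝒟.Sub · ((ℓ, y) : ℕ × X)), w i p := by
        refine Finset.sum_le_sum_of_subset_of_nonneg (fun p hp => ?_) fun p hp _ => ?_
        · obtain ⟨hp, hpG⟩ := Finset.mem_filter.1 hp
          exact Finset.mem_biUnion.2 ⟨𝒟.rep ℓ p.2, hfin.mem_toFinset.2 ⟨p.2, hpG, rfl⟩,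
            Finset.mem_filter.2 ⟨hp, level_ge_of_isRefinement href hℓi hp, rfl⟩⟩
        · obtain ⟨y, -, hp⟩ := Finset.mem_biUnion.1 hp
          exact (hw i).nonneg p (Finset.mem_filter.1 hp).1
    _ = ∑ y ∈ hfin.toFinset, ∑ p ∈ T i with 𝒟.Sub p ((ℓ, y) : ℕ × X), w i p :=
        Finset.sum_biUnion hdisj
    _ ≤ ∑ y ∈ hfin.toFinset, 16 * (2⁻¹ ^ ℓ) ^ b j := by
        refine Finset.sum_le_sum fun y hy => ?_
        obtain ⟨x, -, rfl⟩ := hfin.mem_toFinset.1 hy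
        exact (sum_weight_le hbmono hw href hij (isCell_rep ℓ x) hlev).trans_eq
          (by rw [cellWeight_eq_rpow])
    _ ≤ 𝒟.M * (16 * (2⁻¹ ^ ℓ) ^ b j) := by
        rw [Finset.sum_const, nsmul_eq_mul]
        gcongr
    _ = _ := by ring

/-- A weak limit of the discrete measures carried by the successive antichains. -/
theorem exists_limit_measure [CompactSpace X] (hbmono : Monotone b)
    (hw : ∀ j, 𝒟.IsWeighted t (b j) (T j) (w j))
    (href : ∀ j : ℕ, 𝒟.IsRefinement μ (α + 1 / (j + 1)) (b j) j (T j) (w j) (T (j + 1)) (w (j + 1))) :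
    ∃ ν : ProbabilityMeasure X,
      (∀ j ℓ : ℕ, (∀ p ∈ T j, p.1 ≤ ℓ) → ∀ A : Set X, (∀ x ∈ A, ∀ y ∈ A, dist x y ≤ 2⁻¹ ^ ℓ) →
        (ν : Measure X) A ≤ ENNReal.ofReal (16 * 𝒟.M * (2⁻¹ ^ ℓ) ^ b j)) ∧
      ∀ᵐ x ∂(ν : Measure X), ∀ j, ∃ p ∈ T j, dist x p.2 ≤ 𝒟.C * 2⁻¹ ^ p.1 := by
  let ρ : ℕ → ProbabilityMeasure X := fun i => (hw i).toProbabilityMeasure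
  let U : Ultrafilter ℕ := Ultrafilter.of atTop
  have hU : (U : Filter ℕ) ≤ atTop := Ultrafilter.of_le _
  obtain ⟨ν, -, hν⟩ := isCompact_univ.ultrafilter_le_nhds (U.map ρ) (by simp)
  have hlim : Tendsto ρ U (𝓝 ν) := hν
  refine ⟨ν, fun j ℓ hlev A hA => ?_, ?_⟩
  · have hδ : (0 : ℝ) < 2⁻¹ ^ ℓ := by positivity
    -- Weak limits bound the mass of open sets only, so `A` is thickened; distances grow to at most
    -- `3 * 2⁻¹ ^ ℓ`, within the allowed 4.
    have hdist : ∀ x ∈ Metric.thickening (2⁻¹ ^ ℓ) A, ∀ y ∈ Metric.thickening (2⁻¹ ^ ℓ) A,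
        dist x y ≤ 4 * 2⁻¹ ^ ℓ := by
      intro x hx y hy
      obtain ⟨x', hx', hxx'⟩ := Metric.mem_thickening_iff.1 hx
      obtain ⟨y', hy', hyy'⟩ := Metric.mem_thickening_iff.1 hy
      have h1 := hA x' hx' y' hy'
      have h2 := dist_triangle4 x x' y' y
      rw [dist_comm y' y] at h2
      linarith
    calc (ν : Measure X) A ≤ (ν : Measure X) (Metric.thickening (2⁻¹ ^ ℓ) A) :=
          measure_mono (Metric.self_subset_thickening hδ A)
      _ ≤ liminf (fun i => (ρ i : Measure X) (Metric.thickening (2⁻¹ ^ ℓ) A)) U :=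
          ProbabilityMeasure.le_liminf_measure_open_of_tendsto hlim Metric.isOpen_thickening
      _ ≤ liminf (fun _ => ENNReal.ofReal (16 * 𝒟.M * (2⁻¹ ^ ℓ) ^ b j)) (U : Filter ℕ) := by
          refine liminf_le_liminf (hU ?_)
          filter_upwards [eventually_ge_atTop j, eventually_ge_atTop (ℓ + 1)] with i hi hi'
          exact toProbabilityMeasure_le hbmono hw href hi hi' hlev Metric.isOpen_thickening hdist
      _ = _ := liminf_const _
  · rw [ae_all_iff]
    intro j
    -- Cells need not be closed; closed balls containing them keep full mass in the limit.
    have hclosed : IsClosed (⋃ p ∈ T j, Metric.closedBall p.2 (𝒟.C * 2⁻¹ ^ p.1)) :=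
      isClosed_biUnion_finset fun p _ => Metric.isClosed_closedBall
    have hone : ∀ i, j ≤ i →
        (ρ i : Measure X) (⋃ p ∈ T j, Metric.closedBall p.2 (𝒟.C * 2⁻¹ ^ p.1)) = 1 := by
      classical
      intro i hi
      rw [(hw i).toProbabilityMeasure_apply hclosed.measurableSet, Finset.filter_true_of_mem,
        (hw i).sum_eq_one, ENNReal.ofReal_one]
      intro p hp
      obtain ⟨q, hq, hpq⟩ := exists_ancestor hw href hi hp
      refine Set.mem_iUnion₂.2 ⟨q, hq, ?_⟩
      have := 𝒟.dist_rep q.1 p.2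
      rwa [hpq.2] at this
    have hν1 : 1 ≤ (ν : Measure X) (⋃ p ∈ T j, Metric.closedBall p.2 (𝒟.C * 2⁻¹ ^ p.1)) := by
      refine le_trans ?_ (ProbabilityMeasure.limsup_measure_closed_le_of_tendsto hlim hclosed)
      rw [← limsup_const (f := (U : Filter ℕ)) (1 : ℝ≥0∞)]
      refine limsup_le_limsup (hU ?_)
      filter_upwards [eventually_ge_atTop j] with i hi
      exact (hone i hi).ge
    have hae := (mem_ae_iff_prob_eq_one hclosed.measurableSet).2 (le_antisymm prob_le_one hν1)
    filter_upwards [hae] with x hx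
    obtain ⟨p, hp, hxp⟩ := Set.mem_iUnion₂.1 hx
    exact ⟨p, hp, hxp⟩

end CellSystem

/-! ### The lower bound and the residual set. -/

namespace CellSystem

variable {X : Type*} [MetricSpace X] {𝒟 : CellSystem X} [MeasurableSpace X]
  {t : ℝ} {b : ℕ → ℝ} {T : ℕ → Finset (ℕ × X)} {w : ℕ → ℕ × X → ℝ}

/-- A ball about `x` of radius `(C + 1) 2⁻ˡ` contains the charged ball of a nearby cell of level
`ℓ`. Half of the slack `s - α` absorbs the factor `(C + 1) ^ s`, the other half the error `1 / (j +
1)`. -/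
theorem lowerLocalDim_le_of_isRefinement {μ : Measure X} {α : ℝ}
    (href : ∀ j : ℕ, 𝒟.IsRefinement μ (α + 1 / (j + 1)) (b j) j (T j) (w j) (T (j + 1)) (w (j + 1)))
    {x : X} (hx : ∀ j, ∃ p ∈ T j, dist x p.2 ≤ 𝒟.C * 2⁻¹ ^ p.1) :
    lowerLocalDim μ x ≤ (α : EReal) := by
  have hC := 𝒟.C_nonneg x
  refine EReal.le_of_forall_lt_iff_le.1 fun s hs => lowerLocalDim_le_of_frequently ?_
  have hs : α < s := by exact_mod_cast hs
  rw [(nhdsGT_basis (0 : ℝ)).frequently_iff]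
  intro ε hε
  obtain ⟨n₀, -, hn₀⟩ := exists_level_cellWeight_lt (X := X) (s := 1) (δ := ε / (𝒟.C + 1))
    one_pos (by positivity) 0
  obtain ⟨n₁, -, hn₁⟩ := exists_level_cellWeight_lt (X := X) (s := (s - α) / 2)
    (δ := ((𝒟.C + 1) ^ s)⁻¹) (by linarith) (by positivity) 0
  obtain ⟨n₂, hn₂⟩ := exists_nat_one_div_lt (K := ℝ) (ε := (s - α) / 2) (by linarith)
  set j := max n₀ (max n₁ n₂)
  obtain ⟨p, hp, hxp⟩ := hx (j + 1)
  have hj : (1 : ℝ) / (j + 1) ≤ (s - α) / 2 := by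
    refine le_trans ?_ hn₂.le
    have : (n₂ : ℝ) ≤ j := by exact_mod_cast (le_max_right _ _).trans (le_max_right _ _)
    gcongr
  have hlev := (href j).level p hp
  have h0 := hn₀ p ((le_max_left _ _).trans hlev)
  have h1 := hn₁ p (((le_max_left _ _).trans (le_max_right _ _)).trans hlev)
  rw [cellWeight_one_eq, lt_div_iff₀ (by positivity)] at h0
  refine ⟨(𝒟.C + 1) * 2⁻¹ ^ p.1, ⟨by positivity, by linarith⟩, ?_⟩
  refine le_trans (ENNReal.ofReal_le_ofReal ?_) (((href j).charge p hp).trans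
    (measure_mono (Metric.ball_subset_ball' ?_)))
  · rw [Real.mul_rpow (by positivity) (by positivity), ← cellWeight_eq_rpow]
    calc (𝒟.C + 1) ^ s * cellWeight s p
        = (𝒟.C + 1) ^ s * (cellWeight ((s - α) / 2) p * cellWeight (α + (s - α) / 2) p) := by
          rw [← cellWeight_add]; ring_nf
      _ ≤ (𝒟.C + 1) ^ s * (((𝒟.C + 1) ^ s)⁻¹ * cellWeight (α + (s - α) / 2) p) := by
          have := (cellWeight_pos (α + (s - α) / 2) p).le
          gcongr
      _ = cellWeight (α + (s - α) / 2) p := by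
          rw [mul_inv_cancel_left₀ (by positivity)]
      _ ≤ _ := cellWeight_anti (by linarith) p
  · rw [dist_comm]
    linarith

variable [BorelSpace X] [CompactSpace X]

theorem le_dimH_lowerLevelSet {μ : ProbabilityMeasure X} (hμ : μ ∈ 𝒟.chargingResidual t)
    {α : ℝ≥0} (hα : 0 < α) (hαt : (α : ℝ) ≤ t) (hgood : ∃ Q, 𝒟.Good t Q) :
    (α : ℝ≥0∞) ≤ dimH (lowerLevelSet (μ : Measure X) α) := by
  obtain ⟨Q, hQ⟩ := hgood
  -- Exponents increasing strictly from 0 to `α`; strictness lets `ν` ignore sets of dimension at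
  -- most `β k`, by comparison with `β (k + 1)`.
  let β : ℕ → ℝ≥0 := fun j => α * (j / (j + 1))
  have hβ : ∀ j, (β j : ℝ) = α * (1 - 1 / (j + 1)) := fun j => by
    have : (j : ℝ) + 1 ≠ 0 := by positivity
    simp only [β, NNReal.coe_mul, NNReal.coe_div, NNReal.coe_add, NNReal.coe_natCast, NNReal.coe_one]
    field_simp
    ring
  have hβmono : StrictMono β := by
    refine strictMono_nat_of_lt_succ fun j => ?_
    rw [← NNReal.coe_lt_coe, hβ, hβ]
    have hα' : (0 : ℝ) < α := hα
    gcongr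
    simp
  have hβα : ∀ j, β j < α := fun j => by
    rw [← NNReal.coe_lt_coe, hβ]
    have hα' : (0 : ℝ) < α := hα
    have : (0 : ℝ) < 1 / ((j : ℝ) + 1) := by positivity
    nlinarith
  have hβlim : Tendsto (fun j => (β j : ℝ)) atTop (𝓝 α) := by
    simp only [hβ]
    simpa using ((tendsto_one_div_add_atTop_nhds_zero_nat (𝕜 := ℝ)).const_sub 1).const_mul (α : ℝ)
  have hbmono : Monotone fun j => (β j : ℝ) := fun i j h => hβmono.monotone h
  obtain ⟨T, w, hw, href⟩ := exists_tree (b := fun j => (β j : ℝ)) hμ (by exact_mod_cast hα) hαt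
    (by simp [β]) hbmono (fun j => by exact_mod_cast hβα j) hQ
  obtain ⟨ν, hν, hsupp⟩ := exists_limit_measure hbmono hw href
  have hnull : ∀ j, ∀ A : Set X, μH[(β (j + 1) : ℝ)] A = 0 → (ν : Measure X) A = 0 := by
    intro j A hA
    have hpos : 0 < β (j + 1) := (zero_le : 0 ≤ β j).trans_lt (hβmono (Nat.lt_succ_self j))
    refine measure_eq_zero_of_hausdorffMeasure_eq_zero (b := β (j + 1))
      (c := 16 * 𝒟.M + 1) (by exact_mod_cast hpos) (by positivity)
      ((T (j + 1)).sup Prod.fst) (fun ℓ hℓ B hB => ?_) hA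
    refine (hν (j + 1) ℓ (fun p hp => (Finset.le_sup (f := Prod.fst) hp).trans hℓ) B hB).trans
      (ENNReal.ofReal_le_ofReal ?_)
    gcongr
    linarith
  have hlow : ∀ k, (ν : Measure X) {x | lowerLocalDim (μ : Measure X) x ≤ ((β k : ℝ) : EReal)} =
      0 := fun k => hnull k _ <| hausdorffMeasure_of_dimH_lt <|
    (dimH_setOf_lowerLocalDim_le (μ : Measure X) (β k)).trans_lt <| by
      exact_mod_cast hβmono (Nat.lt_succ_self k)
  have hae : ∀ᵐ x ∂(ν : Measure X), x ∈ lowerLevelSet (μ : Measure X) α := by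
    have h1 : ∀ᵐ x ∂(ν : Measure X), ∀ k,
        ¬ lowerLocalDim (μ : Measure X) x ≤ ((β k : ℝ) : EReal) :=
      ae_all_iff.2 fun k => by simpa [ae_iff] using hlow k
    filter_upwards [h1, hsupp] with x hx1 hx2
    have hle := lowerLocalDim_le_of_isRefinement href hx2
    refine hle.antisymm (not_lt.1 fun hlt => ?_)
    obtain ⟨y, hy1, hy2⟩ := EReal.lt_iff_exists_real_btwn.1 hlt
    obtain ⟨k, hk⟩ := (hβlim.eventually_const_lt (EReal.coe_lt_coe_iff.1 hy2)).exists
    exact hx1 k (hy1.le.trans (EReal.coe_le_coe_iff.2 hk.le))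
  have hge : ∀ j, (β (j + 1) : ℝ≥0∞) ≤ dimH (lowerLevelSet (μ : Measure X) α) := by
    intro j
    refine le_dimH_of_hausdorffMeasure_ne_zero fun h => ?_
    have h2 : (ν : Measure X) (lowerLevelSet (μ : Measure X) α) = 0 := hnull j _ h
    have h3 : (ν : Measure X) Set.univ = 0 := by
      refine measure_mono_null (t := lowerLevelSet (μ : Measure X) α ∪
        (lowerLevelSet (μ : Measure X) α)ᶜ) (by simp) (measure_union_null h2 hae)
    simp at h3
  have hlim : Tendsto (fun j => (β (j + 1) : ℝ≥0∞)) atTop (𝓝 α) :=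
    ENNReal.tendsto_coe.2 (NNReal.tendsto_coe.1 (hβlim.comp (tendsto_add_atTop_nat 1)))
  exact le_of_tendsto' hlim hge

theorem dimH_lowerLevelSet_le (μ : ProbabilityMeasure X) (α : ℝ≥0) :
    dimH (lowerLevelSet (μ : Measure X) α) ≤ α :=
  (dimH_mono fun _ hx => le_of_eq hx).trans (dimH_setOf_lowerLocalDim_le (μ : Measure X) α)

theorem exists_residual_dimH_lowerLevelSet_eq (𝒟 : CellSystem X) :
    ∃ R : Set (ProbabilityMeasure X), IsGδ R ∧ Dense R ∧ ∀ μ ∈ R, ∀ α : ℝ≥0,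
      (α : ℝ≥0∞) < dimH (Set.univ : Set X) ∨
        ((α : ℝ≥0∞) = dimH (Set.univ : Set X) ∧ μH[(α : ℝ)] (Set.univ : Set X) ≠ 0) →
      dimH (lowerLevelSet (μ : Measure X) α) = α := by
  -- Rational `t` serve all `α` below the dimension; the dimension itself serves the endpoint. If it
  -- is infinite, `toReal` adds a harmless 0, as no `α` is then an endpoint.
  let τ : Set ℝ := insert (dimH (Set.univ : Set X)).toReal (Set.range ((↑) : ℚ → ℝ))
  have hτ : τ.Countable := (Set.countable_range _).insert _
  have hG : ∀ t ∈ τ, IsGδ (𝒟.chargingResidual t) := fun t _ => isGδ_chargingResidual t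
  refine ⟨⋂ t ∈ τ, 𝒟.chargingResidual t, .biInter hτ hG,
    dense_biInter_of_Gδ hG hτ fun t _ => dense_chargingResidual t, fun μ hμ α hα => ?_⟩
  refine (dimH_lowerLevelSet_le μ α).antisymm ?_
  rcases eq_zero_or_pos α with rfl | hα0
  · simp
  have key : ∃ t ∈ τ, (α : ℝ) ≤ t ∧ μH[t] (Set.univ : Set X) ≠ 0 := by
    rcases hα with hα | ⟨hα, hne⟩
    · obtain ⟨s, hαs, hs⟩ := ENNReal.lt_iff_exists_nnreal_btwn.1 hα
      obtain ⟨q, hq1, hq2⟩ := exists_rat_btwn (show (α : ℝ) < s by exact_mod_cast hαs)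
      refine ⟨q, Set.mem_insert_of_mem _ ⟨q, rfl⟩, hq1.le, ?_⟩
      have h1 := Measure.hausdorffMeasure_mono hq2.le (Set.univ : Set X)
      rw [hausdorffMeasure_of_lt_dimH hs, top_le_iff] at h1
      simp [h1]
    · exact ⟨α, by simp [τ, ← hα], le_rfl, hne⟩
  obtain ⟨t, htτ, hαt, ht⟩ := key
  have ht0 : 0 < t := lt_of_lt_of_le (by exact_mod_cast hα0) hαt
  exact le_dimH_lowerLevelSet (Set.mem_iInter₂.1 hμ t htτ) hα0 hαt (exists_good ht0 ht)

end CellSystem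

/-! ### Dyadic cubes as a cell system. -/

namespace CellSystem

/-- The cell system whose cells of level `ℓ` are the fibres of `code ℓ`. -/
noncomputable def ofCode {X I : Type*} [PseudoMetricSpace X] (code : ℕ → X → I)
    (hcongr : ∀ {k ℓ : ℕ} {x y : X}, k ≤ ℓ → code ℓ x = code ℓ y → code k x = code k y)
    (hfin : ∀ ℓ, (Set.range (code ℓ)).Finite) (C : ℝ)
    (hdist : ∀ ℓ x y, code ℓ x = code ℓ y → dist x y ≤ C * 2⁻¹ ^ ℓ) (M : ℕ)
    (hcard : ∀ (ℓ : ℕ) (A : Set X),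
      (∀ x ∈ A, ∀ y ∈ A, dist x y ≤ 4 * 2⁻¹ ^ ℓ) → (code ℓ '' A).encard ≤ M) : CellSystem X :=
  let sec : ∀ ℓ, Set.range (code ℓ) → X := fun ℓ =>
    Function.surjInv (Set.rangeFactorization_surjective (f := code ℓ))
  let rep : ℕ → X → X := fun ℓ x => sec ℓ (Set.rangeFactorization (code ℓ) x)
  have hcode : ∀ ℓ x, code ℓ (rep ℓ x) = code ℓ x := fun ℓ x =>
    congrArg Subtype.val (Function.surjInv_eq Set.rangeFactorization_surjective _)
  have hrep : ∀ ℓ x y, code ℓ x = code ℓ y → rep ℓ x = rep ℓ y := fun ℓ _ _ h =>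
    congrArg (sec ℓ) (Subtype.ext h)
  { rep := rep
    rep_rep := fun ℓ x => hrep ℓ _ _ (hcode ℓ x)
    rep_congr := fun {k ℓ x y} hk h => hrep k _ _ <| hcongr hk <| by
      rw [← hcode ℓ x, h, hcode ℓ y]
    finite_range := fun ℓ => by
      have := (hfin ℓ).to_subtype
      exact (Set.finite_range (sec ℓ)).subset (Set.range_subset_iff.2 fun x => ⟨_, rfl⟩)
    C := C
    dist_rep := fun ℓ x => hdist ℓ _ _ (hcode ℓ x).symm
    M := M
    encard_image_le := fun ℓ A hA => by
      refine le_trans ?_ (hcard ℓ A hA)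
      have hmaps : Set.MapsTo (code ℓ) (rep ℓ '' A) (code ℓ '' A) := by
        rintro _ ⟨x, hx, rfl⟩
        exact ⟨x, hx, (hcode ℓ x).symm⟩
      refine Set.encard_le_encard_of_injOn hmaps ?_
      rintro _ ⟨x, -, rfl⟩ _ ⟨y, -, rfl⟩ h
      rw [hcode, hcode] at h
      exact hrep ℓ x y h }

/-- Each floor is the integer half of the one a level deeper, so deeper floors determine shallower
ones. -/
theorem floor_two_pow_mul_congr {k ℓ : ℕ} (hk : k ≤ ℓ) {a b : ℝ}
    (h : ⌊(2 : ℝ) ^ ℓ * a⌋ = ⌊(2 : ℝ) ^ ℓ * b⌋) : ⌊(2 : ℝ) ^ k * a⌋ = ⌊(2 : ℝ) ^ k * b⌋ := by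
  induction ℓ, hk using Nat.le_induction with
  | base => exact h
  | succ ℓ _ ih =>
    refine ih ?_
    have key : ∀ c : ℝ, ⌊(2 : ℝ) ^ ℓ * c⌋ = ⌊(2 : ℝ) ^ (ℓ + 1) * c⌋ / 2 := fun c => by
      have : (2 : ℝ) ^ ℓ * c = (2 : ℝ) ^ (ℓ + 1) * c / (2 : ℕ) := by
        rw [pow_succ]; push_cast; ring
      rw [this, Int.floor_div_natCast]
      rfl
    rw [key, key, h]

/-- The traces on a bounded set of the dyadic cubes of `ℝᵈ`. -/
noncomputable def dyadic {d : ℕ} {K : Set (EuclideanSpace ℝ (Fin d))}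
    (hK : Bornology.IsBounded K) : CellSystem K :=
  ofCode (fun ℓ (x : K) (i : Fin d) => ⌊(2 : ℝ) ^ ℓ * (x : EuclideanSpace ℝ (Fin d)) i⌋)
    (fun hk h => funext fun i => floor_two_pow_mul_congr hk (congrFun h i))
    (fun ℓ => by
      obtain ⟨R, hR⟩ := hK.exists_norm_le
      refine (Set.finite_Icc (fun _ : Fin d => ⌊-((2 : ℝ) ^ ℓ * R)⌋)
        (fun _ => ⌊(2 : ℝ) ^ ℓ * R⌋)).subset (Set.range_subset_iff.2 fun x => ?_)
      have h : ∀ i, |(x : EuclideanSpace ℝ (Fin d)) i| ≤ R := fun i =>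
        (PiLp.norm_apply_le (x : EuclideanSpace ℝ (Fin d)) i).trans (hR x x.2)
      refine ⟨fun i => Int.floor_le_floor ?_, fun i => Int.floor_le_floor ?_⟩
      · rw [← mul_neg]
        gcongr
        exact (abs_le.1 (h i)).1
      · gcongr
        exact (abs_le.1 (h i)).2)
    (√d)
    (fun ℓ x y h => by
      have h2 : (0 : ℝ) < 2 ^ ℓ := by positivity
      have hi : ∀ i, dist ((x : EuclideanSpace ℝ (Fin d)) i) ((y : EuclideanSpace ℝ (Fin d)) i) ≤
          2⁻¹ ^ ℓ := fun i => by
        have h1 := (Int.abs_sub_lt_one_of_floor_eq_floor (congrFun h i)).le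
        rw [← mul_sub, abs_mul, abs_of_pos h2] at h1
        rw [Real.dist_eq, inv_pow, ← one_div, le_div_iff₀ h2]
        linarith
      rw [Subtype.dist_eq, EuclideanSpace.dist_eq, Real.sqrt_le_left (by positivity), mul_pow,
        Real.sq_sqrt (Nat.cast_nonneg d)]
      refine (Finset.sum_le_sum fun i _ => pow_le_pow_left₀ dist_nonneg (hi i) 2).trans ?_
      simp)
    -- After scaling by `2 ^ ℓ`, coordinates differ by at most 4, so their floors differ by at most
    -- 5: eleven values per coordinate.
    (11 ^ d)
    (fun ℓ A hA => by
      rcases A.eq_empty_or_nonempty with rfl | ⟨x, hx⟩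
      · simp
      set c : Fin d → ℤ := fun i => ⌊(2 : ℝ) ^ ℓ * (x : EuclideanSpace ℝ (Fin d)) i⌋
      have hsub : (fun (x : K) (i : Fin d) =>
          ⌊(2 : ℝ) ^ ℓ * (x : EuclideanSpace ℝ (Fin d)) i⌋) '' A ⊆
          (Finset.Icc (c - 5) (c + 5) : Finset (Fin d → ℤ)) := by
        rintro _ ⟨y, hy, rfl⟩
        have h2 : (0 : ℝ) < 2 ^ ℓ := by positivity
        have h3 : ∀ i, |(2 : ℝ) ^ ℓ * (y : EuclideanSpace ℝ (Fin d)) i -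
            (2 : ℝ) ^ ℓ * (x : EuclideanSpace ℝ (Fin d)) i| ≤ 4 := fun i => by
          have h4 := (PiLp.norm_apply_le
            ((y : EuclideanSpace ℝ (Fin d)) - (x : EuclideanSpace ℝ (Fin d))) i).trans
            ((dist_eq_norm _ _).symm.le.trans (hA y hy x hx))
          rw [PiLp.sub_apply, Real.norm_eq_abs, inv_pow, ← div_eq_mul_inv, le_div_iff₀ h2] at h4
          rw [← mul_sub, abs_mul, abs_of_pos h2]
          linarith
        rw [Finset.mem_coe, Finset.mem_Icc]
        refine ⟨fun i => ?_, fun i => ?_⟩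
        · have h5 := (abs_le.1 (h3 i)).1
          change ⌊(2 : ℝ) ^ ℓ * (x : EuclideanSpace ℝ (Fin d)) i⌋ - 5 ≤ _
          rw [Int.le_floor]
          push_cast
          linarith [Int.floor_le ((2 : ℝ) ^ ℓ * (x : EuclideanSpace ℝ (Fin d)) i)]
        · have h5 := (abs_le.1 (h3 i)).2
          change _ ≤ ⌊(2 : ℝ) ^ ℓ * (x : EuclideanSpace ℝ (Fin d)) i⌋ + 5
          refine Int.lt_add_one_iff.1 (Int.floor_lt.2 ?_)
          push_cast
          linarith [Int.lt_floor_add_one ((2 : ℝ) ^ ℓ * (x : EuclideanSpace ℝ (Fin d)) i)]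
      refine (Set.encard_le_encard hsub).trans ?_
      rw [Set.encard_coe_eq_coe_finsetCard, Pi.card_Icc]
      have : ∀ i, (Finset.Icc ((c - 5) i) ((c + 5) i)).card = 11 := fun i => by
        rw [Int.card_Icc, Pi.add_apply, Pi.sub_apply]
        change (c i + 5 + 1 - (c i - 5)).toNat = 11
        ring_nf
        rfl
      rw [Finset.prod_congr rfl fun i _ => this i]
      simp)

end CellSystem

/-! ### Transfer from the subtype to the ambient space. -/

theorem theorem1 (d : ℕ) (K : Set (EuclideanSpace ℝ (Fin d))) (hK : IsCompact K) :
    ∃ R : Set (ProbabilityMeasure K), IsGδ R ∧ Dense R ∧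
      ∀ μ ∈ R,
        (∀ α : ℝ≥0, (α : ℝ≥0∞) < dimH K →
          dimH ((↑) '' lowerLevelSet (μ : Measure K) α : Set (EuclideanSpace ℝ (Fin d))) = α) ∧
        (∀ α : ℝ≥0, (α : ℝ≥0∞) = dimH K → 0 < μH[(α : ℝ)] K →
          dimH ((↑) '' lowerLevelSet (μ : Measure K) α : Set (EuclideanSpace ℝ (Fin d))) = α) := by
  have : CompactSpace K := isCompact_iff_compactSpace.1 hK
  have hisom : Isometry ((↑) : K → EuclideanSpace ℝ (Fin d)) := isometry_subtype_coe
  have himage : ((↑) : K → EuclideanSpace ℝ (Fin d)) '' Set.univ = K := by simp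
  have hdim : dimH (Set.univ : Set K) = dimH K := by rw [← hisom.dimH_image, himage]
  obtain ⟨R, hG, hD, hR⟩ :=
    (CellSystem.dyadic hK.isBounded).exists_residual_dimH_lowerLevelSet_eq
  refine ⟨R, hG, hD, fun μ hμ => ⟨fun α hα => ?_, fun α hα hpos => ?_⟩⟩
  · rw [hisom.dimH_image]
    exact hR μ hμ α (Or.inl (hdim ▸ hα))
  · rw [hisom.dimH_image]
    refine hR μ hμ α (Or.inr ⟨hdim ▸ hα, ?_⟩)
    rw [← hisom.hausdorffMeasure_image (Or.inl α.coe_nonneg), himage]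
    exact hpos.ne'
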